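/- Let $\Bbbk$ be a field of characteristic $0$ and let $U(2)$ be the Weyl associative conformal algebra, i.e. the universal associative conformal envelope of the Virasoro Lie conformal algebra relative to the locality bound $N(v,v)=2$: the associative conformal algebra generated by one element $v$ with defining relations $(v_{(n)}v)=0$ for $n\ge 2$ and $[v_{(\lambda)}v]=(\partial+2\lambda)v$, where $[v_{(\lambda)} v]=(v_{(\lambda)}v)-(v_{(-\partial-\lambda)}v)$. For $\alpha\in\Bbbk$ let $M_{(\alpha,0)}=\Bbbk[\partial]u$ be the (non-irreducible) conformal $U(2)$-module, free of rank one over $\Bbbk[\partial]$, with $(v_{(\lambda)}u)=(\partial+\alpha)u$, considered as a bimodule with zero right action. Let $A_+=\mathcal A_+(U(2))$ be the associative algebra spanned by the elements $a(n)$, $a\in U(2)$, $n\ge 0$, linear in $a$, with $(\partial a)(n)=-n\,a(n-1)$ and $a(m)b(n)=\sum_{s\ge0}\binom ms (a_{(s)}b)(m+n-s)$; it acts on $M=M_{(\alpha,0)}$ by $a(n)w=(a_{(n)}w)$ and has the derivation $\partial a(n)=-n\,a(n-1)$. Let $\tilde C^n=\mathrm{Hom}(A_+^{\otimes n},M)$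 be the Hochschild complex of $A_+$ with values in $M$ and put $$(D^n\varphi)(x_1,\dots,x_n)=\partial\varphi(x_1,\dots,x_n)-\sum_{i=1}^n\varphi(x_1,\dots,\partial x_i,\dots,x_n).$$ The Hochschild cohomology $H^n(U(2),M)$ is the $n$-th cohomology of the reduced complex $C^\bullet=\tilde C^\bullet/D^\bullet\tilde C^\bullet$. Then $$H^n(U(2),M_{(\alpha,0)})=0\qquad\text{for all } n\ge 2 .$$ The same holds if $\tilde C^\bullet$ is replaced by its subcomplex of local cochains, i.e. those $\varphi$ for which, given $a_1,\dots,a_n\in U(2)$, only finitely many of the values $\varphi(a_1(m_1),\dots,a_n(m_n))$ are non-zero (equivalently, sesqui-linear maps $U(2)^{\otimes n}\to M[\lambda_1,\dots,\lambda_n]$). -/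

import Mathlib

noncomputable section

open Finset Polynomial

namespace Conformal

/-! ### Associative conformal algebras and their modules -/

/-- An associative conformal algebra over a field `k` (of characteristic `0`) in the language of
`n`-products, `a_(λ) b = ∑ n, (λ ^ n / n!) (a_(n) b)`: a `k[∂]`-module with bilinear `n`-products
such that `a_(λ) b` is a polynomial in `λ`, `(∂a)_(λ) b = -λ (a_(λ) b)`,
`a_(λ) (∂b) = (∂ + λ) (a_(λ) b)` and `a_(λ) (b_(μ) c) = (a_(λ) b)_(λ+μ) c`. -/
class AssocConformalAlgebra (k : Type*) (C : Type*) [Field k] [AddCommGroup C] [Module k C] where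
  /-- the operator `∂` -/
  der : C →ₗ[k] C
  /-- `nprod n a b` is the `n`-product `a_(n) b` -/
  nprod : ℕ → C →ₗ[k] C →ₗ[k] C
  locality : ∀ a b : C, ∃ N : ℕ, ∀ n : ℕ, N ≤ n → nprod n a b = 0
  der_nprod : ∀ (n : ℕ) (a b : C), nprod n (der a) b = -(n • nprod (n - 1) a b)
  nprod_der : ∀ (n : ℕ) (a b : C), nprod n a (der b) = der (nprod n a b) + n • nprod (n - 1) a b
  assoc : ∀ (n m : ℕ) (a b c : C), nprod n a (nprod m b c) =
    ∑ p ∈ antidiagonal n, n.choose p.1 • nprod (m + p.2) (nprod p.1 a b) c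

/-- A (left) conformal module over an associative conformal algebra, in the language of
`n`-products `a_(λ) u = ∑ n, (λ ^ n / n!) (a_(n) u)`. -/
class ConformalModule (k : Type*) (C : Type*) (M : Type*) [Field k] [AddCommGroup C] [Module k C]
    [AssocConformalAlgebra k C] [AddCommGroup M] [Module k M] where
  /-- the operator `∂` on the module -/
  mder : M →ₗ[k] M
  /-- `act n a u` is the `n`-product `a_(n) u` -/
  act : ℕ → C →ₗ[k] M →ₗ[k] M
  act_locality : ∀ (a : C) (u : M), ∃ N : ℕ, ∀ n : ℕ, N ≤ n → act n a u = 0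
  der_act : ∀ (n : ℕ) (a : C) (u : M),
    act n (AssocConformalAlgebra.der (k := k) a) u = -(n • act (n - 1) a u)
  act_der : ∀ (n : ℕ) (a : C) (u : M), act n a (mder u) = mder (act n a u) + n • act (n - 1) a u
  act_assoc : ∀ (n m : ℕ) (a b : C) (u : M), act n a (act m b u) =
    ∑ p ∈ antidiagonal n, n.choose p.1 •
      act (m + p.2) (AssocConformalAlgebra.nprod (k := k) p.1 a b) u

/-! ### The conformal algebra `U(2)` -/

/-- Words in one letter `v`, a unary operation `∂` and binary operations, the `n`-products. -/
inductive Word : Type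
  | v : Word
  | der : Word → Word
  | nprod : ℕ → Word → Word → Word

/-- The free linear algebra with operations `∂` and `(n)`, `n ≥ 0`, generated by `v`. -/
abbrev FreeOp (k : Type*) [Field k] : Type _ := Word →₀ k

namespace FreeOp

variable (k : Type*) [Field k]

/-- The generator. -/
def v : FreeOp k := Finsupp.single Word.v 1

/-- `∂` on the free algebra. -/
def der : FreeOp k →ₗ[k] FreeOp k := Finsupp.lmapDomain k k Word.der

/-- The `n`-products on the free algebra. -/
def nprod (n : ℕ) : FreeOp k →ₗ[k] FreeOp k →ₗ[k] FreeOp k :=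
  Finsupp.linearCombination k (fun w => Finsupp.lmapDomain k k (Word.nprod n w))

/-- A subspace of the free algebra is admissible if it is an ideal (closed under `∂` and under all
`n`-products with arbitrary elements) which contains all relations defining `U(2)`:
sesqui-linearity, associativity, locality `N(v, v) = 2` and the Virasoro relation
`v_(λ) v - v_(-∂-λ) v = (∂ + 2λ) v`. Since `v_(λ) v = v_(0) v + λ (v_(1) v)` by locality, the
latter says `v_(0) v - (v_(0) v - ∂(v_(1) v)) = ∂ v` and `v_(1) v + v_(1) v = 2 v`. -/
structure IsAdmissible (N : Submodule k (FreeOp k)) : Prop where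
  der_mem : ∀ x ∈ N, der k x ∈ N
  nprod_mem_left : ∀ (n : ℕ) (x y : FreeOp k), x ∈ N → nprod k n x y ∈ N
  nprod_mem_right : ∀ (n : ℕ) (x y : FreeOp k), y ∈ N → nprod k n x y ∈ N
  der_nprod : ∀ (n : ℕ) (x y : FreeOp k),
    nprod k n (der k x) y - -(n • nprod k (n - 1) x y) ∈ N
  nprod_der : ∀ (n : ℕ) (x y : FreeOp k),
    nprod k n x (der k y) - (der k (nprod k n x y) + n • nprod k (n - 1) x y) ∈ N
  assoc : ∀ (n m : ℕ) (x y z : FreeOp k), nprod k n x (nprod k m y z) -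
    ∑ p ∈ antidiagonal n, n.choose p.1 • nprod k (m + p.2) (nprod k p.1 x y) z ∈ N
  locality : ∀ n : ℕ, 2 ≤ n → nprod k n (v k) (v k) ∈ N
  vir_zero : nprod k 0 (v k) (v k) - (nprod k 0 (v k) (v k) - der k (nprod k 1 (v k) (v k))) -
    der k (v k) ∈ N
  vir_one : nprod k 1 (v k) (v k) + nprod k 1 (v k) (v k) - 2 • v k ∈ N

/-- The ideal of relations of `U(2)`: the smallest admissible subspace. -/
def relations : Submodule k (FreeOp k) := sInf {N | IsAdmissible k N}

theorem relations_isAdmissible : IsAdmissible k (relations k) where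
  der_mem x hx := by
    simp only [relations, Submodule.mem_sInf, Set.mem_ofPred_eq] at hx ⊢
    exact fun N hN => hN.der_mem x (hx N hN)
  nprod_mem_left n x y hx := by
    simp only [relations, Submodule.mem_sInf, Set.mem_ofPred_eq] at hx ⊢
    exact fun N hN => hN.nprod_mem_left n x y (hx N hN)
  nprod_mem_right n x y hy := by
    simp only [relations, Submodule.mem_sInf, Set.mem_ofPred_eq] at hy ⊢
    exact fun N hN => hN.nprod_mem_right n x y (hy N hN)
  der_nprod n x y := by
    simp only [relations, Submodule.mem_sInf, Set.mem_ofPred_eq]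
    exact fun N hN => hN.der_nprod n x y
  nprod_der n x y := by
    simp only [relations, Submodule.mem_sInf, Set.mem_ofPred_eq]
    exact fun N hN => hN.nprod_der n x y
  assoc n m x y z := by
    simp only [relations, Submodule.mem_sInf, Set.mem_ofPred_eq]
    exact fun N hN => hN.assoc n m x y z
  locality n hn := by
    simp only [relations, Submodule.mem_sInf, Set.mem_ofPred_eq]
    exact fun N hN => hN.locality n hn
  vir_zero := by
    simp only [relations, Submodule.mem_sInf, Set.mem_ofPred_eq]
    exact fun N hN => hN.vir_zero
  vir_one := by
    simp only [relations, Submodule.mem_sInf, Set.mem_ofPred_eq]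
    exact fun N hN => hN.vir_one

end FreeOp

/-- The Weyl conformal algebra `U(2)`: the universal associative conformal envelope of the Virasoro
Lie conformal algebra relative to the associative locality bound `N(v, v) = 2`. It is the
associative conformal algebra generated by `v` with defining relations `v_(n) v = 0` for `n ≥ 2`
and `[v_(λ) v] = (∂ + 2λ) v`. -/
def U2 (k : Type*) [Field k] : Type _ := FreeOp k ⧸ FreeOp.relations k

namespace U2

variable (k : Type*) [Field k]

instance : AddCommGroup (U2 k) := inferInstanceAs (AddCommGroup (FreeOp k ⧸ FreeOp.relations k))

instance : Module k (U2 k) := inferInstanceAs (Module k (FreeOp k ⧸ FreeOp.relations k))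

/-- The projection onto `U(2)`. -/
def mk : FreeOp k →ₗ[k] U2 k := (FreeOp.relations k).mkQ

theorem mk_surjective : Function.Surjective (mk k) := Submodule.mkQ_surjective _

theorem mk_eq_zero {x : FreeOp k} : mk k x = 0 ↔ x ∈ FreeOp.relations k :=
  Submodule.Quotient.mk_eq_zero _

theorem mk_eq_mk {x y : FreeOp k} : mk k x = mk k y ↔ x - y ∈ FreeOp.relations k := by
  rw [← mk_eq_zero, map_sub, sub_eq_zero]

/-- The generator `v` of `U(2)`. -/
def v : U2 k := mk k (FreeOp.v k)

/-- `∂` on `U(2)`. -/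
def der : U2 k →ₗ[k] U2 k :=
  (FreeOp.relations k).mapQ (FreeOp.relations k) (FreeOp.der k)
    (fun x hx => (FreeOp.relations_isAdmissible k).der_mem x hx)

/-- The `n`-products on `U(2)`. -/
def nprod (n : ℕ) : U2 k →ₗ[k] U2 k →ₗ[k] U2 k :=
  (FreeOp.relations k).liftQ
    { toFun := fun x => (FreeOp.relations k).mapQ (FreeOp.relations k) (FreeOp.nprod k n x)
        (fun y hy => (FreeOp.relations_isAdmissible k).nprod_mem_right n x y hy)
      map_add' := fun x x' => by
        refine Submodule.linearMap_qext _ (LinearMap.ext fun y => ?_)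
        exact congrArg (mk k)
          (by simp : FreeOp.nprod k n (x + x') y = FreeOp.nprod k n x y + FreeOp.nprod k n x' y)
      map_smul' := fun c x => by
        refine Submodule.linearMap_qext _ (LinearMap.ext fun y => ?_)
        exact congrArg (mk k) (by simp : FreeOp.nprod k n (c • x) y = c • FreeOp.nprod k n x y) }
    (fun x hx => by
      refine Submodule.linearMap_qext _ (LinearMap.ext fun y => ?_)
      exact (mk_eq_zero k).2 ((FreeOp.relations_isAdmissible k).nprod_mem_left n x y hx))

theorem der_mk (x : FreeOp k) : der k (mk k x) = mk k (FreeOp.der k x) := rfl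

theorem nprod_mk (n : ℕ) (x y : FreeOp k) :
    nprod k n (mk k x) (mk k y) = mk k (FreeOp.nprod k n x y) := rfl

theorem der_nprod (n : ℕ) (a b : U2 k) :
    nprod k n (der k a) b = -(n • nprod k (n - 1) a b) := by
  obtain ⟨x, rfl⟩ := mk_surjective k a
  obtain ⟨y, rfl⟩ := mk_surjective k b
  simp only [der_mk, nprod_mk, ← map_nsmul (mk k), ← map_neg (mk k)]
  exact (mk_eq_mk k).2 ((FreeOp.relations_isAdmissible k).der_nprod n x y)

theorem nprod_der (n : ℕ) (a b : U2 k) :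
    nprod k n a (der k b) = der k (nprod k n a b) + n • nprod k (n - 1) a b := by
  obtain ⟨x, rfl⟩ := mk_surjective k a
  obtain ⟨y, rfl⟩ := mk_surjective k b
  simp only [der_mk, nprod_mk, ← map_nsmul (mk k), ← map_add (mk k)]
  exact (mk_eq_mk k).2 ((FreeOp.relations_isAdmissible k).nprod_der n x y)

theorem assoc (n m : ℕ) (a b c : U2 k) : nprod k n a (nprod k m b c) =
    ∑ p ∈ antidiagonal n, n.choose p.1 • nprod k (m + p.2) (nprod k p.1 a b) c := by
  obtain ⟨x, rfl⟩ := mk_surjective k a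
  obtain ⟨y, rfl⟩ := mk_surjective k b
  obtain ⟨z, rfl⟩ := mk_surjective k c
  simp only [nprod_mk, ← map_nsmul (mk k), ← map_sum (mk k)]
  exact (mk_eq_mk k).2 ((FreeOp.relations_isAdmissible k).assoc n m x y z)

theorem v_nprod_v (n : ℕ) (hn : 2 ≤ n) : nprod k n (v k) (v k) = 0 :=
  (mk_eq_zero k).2 ((FreeOp.relations_isAdmissible k).locality n hn)

/-- The pair `(a, b)` is local. -/
def Loc (a b : U2 k) : Prop := ∃ N : ℕ, ∀ n : ℕ, N ≤ n → nprod k n a b = 0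

variable {k}

theorem Loc.der_left {a b : U2 k} (h : Loc k a b) : Loc k (der k a) b := by
  obtain ⟨N, hN⟩ := h
  refine ⟨N + 1, fun n hn => ?_⟩
  rw [der_nprod, hN (n - 1) (by omega), smul_zero, neg_zero]

theorem Loc.der_right {a b : U2 k} (h : Loc k a b) : Loc k a (der k b) := by
  obtain ⟨N, hN⟩ := h
  refine ⟨N + 1, fun n hn => ?_⟩
  rw [nprod_der, hN (n - 1) (by omega), hN n (by omega), smul_zero, map_zero, add_zero]

theorem Loc.nprod_left {b c : U2 k} (h : Loc k b c) (a : U2 k) (n : ℕ) :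
    Loc k (nprod k n a b) c := by
  obtain ⟨K, hK⟩ := h
  induction n using Nat.strong_induction_on with
  | _ n ih =>
    choose! L hL using ih
    refine ⟨K + ∑ j ∈ range n, L j, fun m hm => ?_⟩
    have h1 := assoc k n m a b c
    rw [hK m (by omega), map_zero, Finset.sum_eq_single (n, 0)] at h1
    · simpa using h1.symm
    · rintro ⟨i, j⟩ hp hne
      simp only [HasAntidiagonal.mem_antidiagonal] at hp
      have hi : i < n := by
        rcases Nat.lt_or_ge i n with h | h
        · exact h
        · exact absurd (Prod.ext (by simp; omega) (by simp; omega)) hne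
      have : L i ≤ ∑ j ∈ range n, L j :=
        Finset.single_le_sum (f := L) (fun _ _ => Nat.zero_le _) (mem_range.2 hi)
      simp only
      rw [hL i hi (m + j) (by omega), smul_zero]
    · intro h
      simp at h

theorem Loc.nprod_right {a b c : U2 k} (h : Loc k a b) (h' : Loc k b c) (m : ℕ) :
    Loc k a (nprod k m b c) := by
  obtain ⟨N, hN⟩ := h
  have hl : ∀ j, Loc k (nprod k j a b) c := fun j => h'.nprod_left a j
  choose L hL using hl
  refine ⟨N + ∑ j ∈ range N, L j, fun n hn => ?_⟩
  rw [assoc]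
  refine Finset.sum_eq_zero ?_
  rintro ⟨i, j⟩ hp
  simp only [HasAntidiagonal.mem_antidiagonal] at hp
  simp only
  rcases Nat.lt_or_ge i N with hi | hi
  · have : L i ≤ ∑ j ∈ range N, L j :=
      Finset.single_le_sum (f := L) (fun _ _ => Nat.zero_le _) (mem_range.2 hi)
    rw [hL i (m + j) (by omega), smul_zero]
  · rw [hN i hi, map_zero, LinearMap.zero_apply, smul_zero]

theorem freeOp_der_single (w : Word) :
    FreeOp.der k (Finsupp.single w 1) = Finsupp.single (Word.der w) 1 := by
  simp [FreeOp.der, Finsupp.lmapDomain_apply, Finsupp.mapDomain_single]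

theorem freeOp_nprod_single (n : ℕ) (w w' : Word) :
    FreeOp.nprod k n (Finsupp.single w 1) (Finsupp.single w' 1) =
      Finsupp.single (Word.nprod n w w') 1 := by
  simp [FreeOp.nprod, Finsupp.lmapDomain_apply, Finsupp.mapDomain_single]

theorem loc_word : ∀ w w' : Word,
    Loc k (mk k (Finsupp.single w 1)) (mk k (Finsupp.single w' 1))
  | Word.v, Word.v => ⟨2, fun n hn => v_nprod_v k n hn⟩
  | Word.der w, w' => by
    rw [← freeOp_der_single, ← der_mk]
    exact (loc_word w w').der_left
  | Word.nprod n w₁ w₂, w' => by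
    rw [← freeOp_nprod_single, ← nprod_mk]
    exact (loc_word w₂ w').nprod_left _ n
  | Word.v, Word.der w' => by
    rw [← freeOp_der_single, ← der_mk]
    exact (loc_word Word.v w').der_right
  | Word.v, Word.nprod m w₁ w₂ => by
    rw [← freeOp_nprod_single, ← nprod_mk]
    exact (loc_word Word.v w₁).nprod_right (loc_word w₁ w₂) m
  termination_by w w' => sizeOf w + sizeOf w'

theorem locality (a b : U2 k) : Loc k a b := by
  obtain ⟨x, rfl⟩ := mk_surjective k a
  obtain ⟨y, rfl⟩ := mk_surjective k b
  induction x using Finsupp.induction_linear with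
  | zero => exact ⟨0, fun n _ => by simp⟩
  | add x x' h h' =>
    obtain ⟨N, hN⟩ := h
    obtain ⟨N', hN'⟩ := h'
    exact ⟨N + N', fun n hn => by
      rw [map_add, map_add, LinearMap.add_apply, hN n (by omega), hN' n (by omega), add_zero]⟩
  | single w c =>
    induction y using Finsupp.induction_linear with
    | zero => exact ⟨0, fun n _ => by simp⟩
    | add y y' h h' =>
      obtain ⟨N, hN⟩ := h
      obtain ⟨N', hN'⟩ := h'
      exact ⟨N + N', fun n hn => by
        rw [map_add, map_add, hN n (by omega), hN' n (by omega), add_zero]⟩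
    | single w' c' =>
      obtain ⟨N, hN⟩ := loc_word (k := k) w w'
      refine ⟨N, fun n hn => ?_⟩
      rw [← mul_one c, ← mul_one c', ← smul_eq_mul, ← smul_eq_mul, ← Finsupp.smul_single,
        ← Finsupp.smul_single, map_smul, map_smul, map_smul, map_smul, LinearMap.smul_apply,
        hN n hn, smul_zero, smul_zero]

instance : AssocConformalAlgebra k (U2 k) where
  der := der k
  nprod := nprod k
  locality := locality
  der_nprod := der_nprod k
  nprod_der := nprod_der k
  assoc := assoc k

end U2

/-! ### The modules `M_(α,Δ)` -/

/-- The `n`-product of two sequences `A, B` of elements of an associative algebra, i.e. of two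
formal power series `∑ n, (λ ^ n / n!) A n`: the conformal product
`(A_(m) B)(n) = ∑ s, (-1) ^ s * choose m s * A (m - s) * B (n + s)`. -/
def seqProd {E : Type*} [Ring E] (m : ℕ) (A B : ℕ → E) : ℕ → E := fun n =>
  ∑ p ∈ antidiagonal m, m.choose p.1 • ((-1 : ℤ) ^ p.2 • (A p.1 * B (n + p.2)))

/-- The operator `∂` on sequences: `(∂A)(n) = -n A(n-1)`. -/
def seqDer {E : Type*} [Ring E] (A : ℕ → E) : ℕ → E := fun n => -(n • A (n - 1))

/-- The Virasoro module `M_(α,Δ) = k[∂] u`, `v_(λ) u = (∂ + α + Δ λ) u`, realized on polynomials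
`f = f(∂) u` in one variable `X = ∂`. Since `v_(λ) (f(∂) u) = f(∂ + λ) (∂ + α + Δ λ) u`, we have
`v_(n) f = (∂ + α) f^(n) + n Δ f^(n-1)`. -/
def virAct {k : Type*} [Field k] (α Δ : k) : ℕ → Module.End k k[X] := fun n =>
  LinearMap.mulLeft k (X + C α) * derivative ^ n + (n * Δ) • derivative ^ (n - 1)

/-- The action of words on `M_(α,0)`: the `n`-th operator `w_(n)` of a word `w`. -/
def wordAct {k : Type*} [Field k] (α : k) : Word → ℕ → Module.End k k[X]
  | Word.v => virAct α 0
  | Word.der w => seqDer (wordAct α w)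
  | Word.nprod m w w' => seqProd m (wordAct α w) (wordAct α w')

section Seq

variable {E : Type*} [Ring E]

/-- The shift of a sequence. -/
def shift (A : ℕ → E) : ℕ → E := fun n => A (n + 1)

theorem seqProd_zero (A B : ℕ → E) : seqProd 0 A B = fun n => A 0 * B n := by
  funext n; simp [seqProd]

theorem seqProd_shift (m : ℕ) (A B : ℕ → E) :
    seqProd m A (shift B) = shift (seqProd m A B) := by
  funext n
  simp only [seqProd, shift]
  refine Finset.sum_congr rfl fun p _ => ?_
  rw [show n + p.2 + 1 = n + 1 + p.2 by omega]

theorem seqProd_succ (m : ℕ) (A B : ℕ → E) :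
    seqProd (m + 1) A B = seqProd m (shift A) B - shift (seqProd m A B) := by
  funext n
  simp only [seqProd, shift, Pi.sub_apply]
  rw [Finset.sum_antidiagonal_choose_succ_nsmul
    (fun i j => (-1 : ℤ) ^ j • (A i * B (n + j))) m, add_comm, sub_eq_add_neg,
    ← Finset.sum_neg_distrib]
  congr 1
  · refine Finset.sum_congr rfl fun p hp => ?_
    rw [← Nat.choose_symm_of_eq_add (HasAntidiagonal.mem_antidiagonal.1 hp).symm]
  · refine Finset.sum_congr rfl fun p _ => ?_
    rw [pow_succ, show n + (p.2 + 1) = n + 1 + p.2 by omega]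
    simp

theorem seqProd_add_left (m : ℕ) (A A' B : ℕ → E) :
    seqProd m (A + A') B = seqProd m A B + seqProd m A' B := by
  funext n
  simp [seqProd, add_mul, Finset.sum_add_distrib, smul_add]

theorem seqProd_add_right (m : ℕ) (A B B' : ℕ → E) :
    seqProd m A (B + B') = seqProd m A B + seqProd m A B' := by
  funext n
  simp [seqProd, mul_add, Finset.sum_add_distrib, smul_add]

theorem seqProd_smul_left {k : Type*} [Field k] [Algebra k E] (m : ℕ) (c : k) (A B : ℕ → E) :
    seqProd m (c • A) B = c • seqProd m A B := by
  funext n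
  simp only [seqProd, Pi.smul_apply, Finset.smul_sum, smul_mul_assoc]
  refine Finset.sum_congr rfl fun p _ => ?_
  rw [smul_comm _ c, smul_comm _ c]

theorem seqProd_smul_right {k : Type*} [Field k] [Algebra k E] (m : ℕ) (c : k) (A B : ℕ → E) :
    seqProd m A (c • B) = c • seqProd m A B := by
  funext n
  simp only [seqProd, Pi.smul_apply, Finset.smul_sum, mul_smul_comm]
  refine Finset.sum_congr rfl fun p _ => ?_
  rw [smul_comm _ c, smul_comm _ c]

theorem seqProd_neg_left (m : ℕ) (A B : ℕ → E) : seqProd m (-A) B = -seqProd m A B := by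
  funext n; simp [seqProd]

theorem seqProd_sub_left (m : ℕ) (A A' B : ℕ → E) :
    seqProd m (A - A') B = seqProd m A B - seqProd m A' B := by
  rw [sub_eq_add_neg, seqProd_add_left, seqProd_neg_left, ← sub_eq_add_neg]

theorem shift_seqDer (A : ℕ → E) : shift (seqDer A) = seqDer (shift A) - A := by
  funext n
  simp only [shift, seqDer, Pi.sub_apply, Nat.add_sub_cancel]
  cases n with
  | zero => simp
  | succ n => simp only [Nat.add_sub_cancel, add_smul, one_smul]; abel

theorem seqDer_sub (A B : ℕ → E) : seqDer (A - B) = seqDer A - seqDer B := by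
  funext n
  simp only [seqDer, Pi.sub_apply, smul_sub]; abel

theorem shift_sub (A B : ℕ → E) : shift (A - B) = shift A - shift B := rfl

theorem shift_add (A B : ℕ → E) : shift (A + B) = shift A + shift B := rfl

theorem shift_nsmul (n : ℕ) (A : ℕ → E) : shift (n • A) = n • shift A := rfl

theorem shift_neg (A : ℕ → E) : shift (-A) = -shift A := rfl

theorem seqProd_seqDer_left (m : ℕ) (A B : ℕ → E) :
    seqProd m (seqDer A) B = -(m • seqProd (m - 1) A B) := by
  induction m generalizing A with
  | zero => funext n; simp [seqProd_zero, seqDer]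
  | succ m ih =>
    rw [seqProd_succ, shift_seqDer, seqProd_sub_left, ih, ih, Nat.add_sub_cancel]
    cases m with
    | zero => funext n; simp [shift]
    | succ m =>
      rw [Nat.add_sub_cancel, shift_neg, shift_nsmul, succ_nsmul (seqProd (m + 1) A B) (m + 1),
        seqProd_succ m A B, smul_sub]
      abel

theorem seqProd_seqDer_right (m : ℕ) (A B : ℕ → E) :
    seqProd m A (seqDer B) = seqDer (seqProd m A B) + m • seqProd (m - 1) A B := by
  induction m generalizing A with
  | zero =>
    funext n
    simp only [seqProd_zero, seqDer, mul_neg, zero_smul, add_zero, mul_smul_comm]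
  | succ m ih =>
    rw [seqProd_succ, ih, ih, Nat.add_sub_cancel, seqProd_succ m A B, seqDer_sub, shift_add,
      shift_seqDer, shift_nsmul]
    cases m with
    | zero => funext n; simp; abel
    | succ m =>
      rw [Nat.add_sub_cancel, succ_nsmul (seqProd (m + 1) A B) (m + 1), seqProd_succ m A B,
        smul_sub]
      abel

theorem seqProd_sum_left {ι : Type*} (s : Finset ι) (m : ℕ) (A : ι → ℕ → E) (B : ℕ → E) :
    seqProd m (∑ i ∈ s, A i) B = ∑ i ∈ s, seqProd m (A i) B := by
  classical
  induction s using Finset.induction_on with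
  | empty => funext n; simp [seqProd]
  | insert i s hi ih => rw [Finset.sum_insert hi, Finset.sum_insert hi, seqProd_add_left, ih]

theorem seqProd_assoc (n m : ℕ) (A B C : ℕ → E) : seqProd n A (seqProd m B C) =
    ∑ p ∈ antidiagonal n, n.choose p.1 • seqProd (m + p.2) (seqProd p.1 A B) C := by
  induction n generalizing A with
  | zero =>
    simp only [Finset.Nat.antidiagonal_zero, sum_singleton, Nat.choose_self, one_smul, add_zero, seqProd_zero]
    funext r
    simp only [seqProd, Finset.mul_sum, mul_assoc, mul_smul_comm]
  | succ n ih =>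
    rw [Finset.sum_antidiagonal_choose_succ_nsmul
      (fun i j => seqProd (m + j) (seqProd i A B) C) n, seqProd_succ, ih, ih, sub_eq_iff_eq_add]
    have h : shift (∑ p ∈ antidiagonal n, n.choose p.1 • seqProd (m + p.2) (seqProd p.1 A B) C) =
        ∑ p ∈ antidiagonal n, n.choose p.1 • shift (seqProd (m + p.2) (seqProd p.1 A B) C) := by
      funext r; simp [shift]
    rw [h, ← Finset.sum_add_distrib, ← Finset.sum_add_distrib]
    refine Finset.sum_congr rfl fun p hp => ?_
    rw [← Nat.choose_symm_of_eq_add (HasAntidiagonal.mem_antidiagonal.1 hp).symm, ← smul_add,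
      ← smul_add]
    congr 1
    rw [← Nat.add_assoc, seqProd_succ (m + p.2), seqProd_succ p.1, seqProd_sub_left]
    abel

theorem mul_eq_sum_seqProd (n m : ℕ) (A B : ℕ → E) : A n * B m =
    ∑ p ∈ antidiagonal n, n.choose p.1 • seqProd p.1 A B (m + p.2) := by
  induction n generalizing A with
  | zero => simp [seqProd_zero]
  | succ n ih =>
    rw [Finset.sum_antidiagonal_choose_succ_nsmul (fun i j => seqProd i A B (m + j)) n,
      ← Finset.sum_add_distrib]
    refine (ih (shift A)).trans (Finset.sum_congr rfl fun p hp => ?_)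
    rw [← Nat.choose_symm_of_eq_add (HasAntidiagonal.mem_antidiagonal.1 hp).symm, ← smul_add]
    congr 1
    rw [seqProd_succ p.1, ← Nat.add_assoc]
    simp [shift]

theorem seqProd_commutator (m : ℕ) (A B : ℕ → E) (x : E) :
    (fun n => seqProd m A B n * x - x * seqProd m A B n) =
      seqProd m (fun n => A n * x - x * A n) B + seqProd m A (fun n => B n * x - x * B n) := by
  funext n
  simp only [seqProd, Pi.add_apply, Finset.sum_mul, Finset.mul_sum, ← Finset.sum_add_distrib,
    ← Finset.sum_sub_distrib]
  refine Finset.sum_congr rfl fun p _ => ?_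
  simp only [smul_mul_assoc, mul_smul_comm, ← smul_add, ← smul_sub]
  congr 2
  noncomm_ring

/-- A sequence `A` with `[A n, x] = n A (n - 1)` for all `n`. -/
def Sesqui (x : E) (A : ℕ → E) : Prop := (fun n => A n * x - x * A n) = -seqDer A

theorem Sesqui.seqDer {x : E} {A : ℕ → E} (h : Sesqui x A) : Sesqui x (seqDer A) := by
  funext n
  have := congrFun h (n - 1)
  simp only [Conformal.seqDer, Pi.neg_apply, neg_neg] at this ⊢
  rw [neg_mul, mul_neg, smul_mul_assoc, mul_smul_comm, sub_neg_eq_add, neg_add_eq_sub,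
    ← smul_sub, ← neg_sub, this, smul_neg]

theorem Sesqui.seqProd {x : E} {A B : ℕ → E} (hA : Sesqui x A) (hB : Sesqui x B) (m : ℕ) :
    Sesqui x (seqProd m A B) := by
  unfold Sesqui at *
  rw [seqProd_commutator, hA, hB, seqProd_neg_left, seqProd_seqDer_left, ← neg_one_smul ℤ,
    ← neg_one_smul ℤ (Conformal.seqDer B)]
  have : Conformal.seqProd m A ((-1 : ℤ) • Conformal.seqDer B) =
      -Conformal.seqProd m A (Conformal.seqDer B) := by
    funext n; simp [Conformal.seqProd]
  rw [this, seqProd_seqDer_right]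
  simp

variable {q t : E}

theorem seqProd_one_weyl (h : t * q = q * t + 1) (i j : ℕ) :
    seqProd 1 (fun n => q * t ^ (n + i)) (fun n => q * t ^ (n + j)) =
      fun n => q * t ^ (n + (i + j)) := by
  funext n
  have e : seqProd 1 (fun n => q * t ^ (n + i)) (fun n => q * t ^ (n + j)) n =
      q * t ^ i * (t * q) * t ^ (n + j) - q * t ^ i * q * t * t ^ (n + j) := by
    rw [seqProd_succ, seqProd_zero, seqProd_zero]
    simp only [shift, Pi.sub_apply, zero_add]
    rw [add_comm 1 i, pow_succ, show n + 1 + j = n + j + 1 by omega, pow_succ']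
    noncomm_ring
  rw [e, h, show n + (i + j) = i + (n + j) by omega, pow_add t i]
  noncomm_ring

theorem seqProd_two_weyl (h : t * q = q * t + 1) (m i j : ℕ) :
    seqProd (m + 2) (fun n => q * t ^ (n + i)) (fun n => q * t ^ (n + j)) = 0 := by
  have hs : ∀ i, shift (fun n => q * t ^ (n + i)) = fun n => q * t ^ (n + (i + 1)) := by
    intro i; funext n; simp only [shift]; rw [show n + 1 + i = n + (i + 1) by omega]
  induction m generalizing i with
  | zero =>
    rw [zero_add, seqProd_succ, hs, seqProd_one_weyl h, seqProd_one_weyl h, hs,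
      show i + 1 + j = i + j + 1 by omega, sub_self]
  | succ m ih =>
    rw [show m + 1 + 2 = (m + 2) + 1 by omega, seqProd_succ, hs, ih, ih]
    funext n; simp [shift]

end Seq

section VirModule

variable {k : Type*} [Field k] (α : k)

theorem virAct_zero : virAct α 0 =
    fun n => LinearMap.mulLeft k (X + C α) * (derivative : Module.End k k[X]) ^ (n + 0) := by
  funext n; simp [virAct]

theorem derivative_mul_mulLeft :
    (derivative : Module.End k k[X]) * LinearMap.mulLeft k (X + C α) =
      LinearMap.mulLeft k (X + C α) * derivative + 1 := by
  refine LinearMap.ext fun f => ?_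
  simp [Module.End.mul_apply]
  ring

/-- The action of the free algebra on `M_(α,0)`. -/
def freeAct : FreeOp k →ₗ[k] (ℕ → Module.End k k[X]) := Finsupp.linearCombination k (wordAct α)

theorem freeAct_single (w : Word) : freeAct α (Finsupp.single w 1) = wordAct α w := by
  simp [freeAct]

theorem freeAct_der (x : FreeOp k) : freeAct α (FreeOp.der k x) = seqDer (freeAct α x) := by
  induction x using Finsupp.induction_linear with
  | zero => funext n; simp [seqDer]
  | add x y hx hy =>
    rw [map_add, map_add, hx, hy, map_add]
    funext n; simp only [seqDer, Pi.add_apply, smul_add]; abel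
  | single w c =>
    rw [← mul_one c, ← smul_eq_mul, ← Finsupp.smul_single, map_smul, map_smul, map_smul,
      U2.freeOp_der_single, freeAct_single, freeAct_single]
    funext n
    simp only [wordAct, seqDer, Pi.smul_apply, smul_neg]
    rw [smul_comm]

theorem freeAct_nprod (m : ℕ) (x y : FreeOp k) :
    freeAct α (FreeOp.nprod k m x y) = seqProd m (freeAct α x) (freeAct α y) := by
  induction x using Finsupp.induction_linear with
  | zero => funext n; simp [seqProd]
  | add x x' hx hx' =>
    rw [map_add, LinearMap.add_apply, map_add, hx, hx', map_add, seqProd_add_left]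
  | single w c =>
    induction y using Finsupp.induction_linear with
    | zero => funext n; simp [seqProd]
    | add y y' hy hy' => rw [map_add, map_add, hy, hy', map_add, seqProd_add_right]
    | single w' c' =>
      rw [← mul_one c, ← mul_one c', ← smul_eq_mul, ← smul_eq_mul, ← Finsupp.smul_single,
        ← Finsupp.smul_single]
      simp only [map_smul, LinearMap.smul_apply]
      rw [U2.freeOp_nprod_single, freeAct_single, freeAct_single, freeAct_single,
        seqProd_smul_left, seqProd_smul_right, wordAct, smul_comm]

theorem ker_freeAct_isAdmissible : FreeOp.IsAdmissible k (LinearMap.ker (freeAct α)) where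
  der_mem x hx := by
    rw [LinearMap.mem_ker] at hx ⊢
    rw [freeAct_der, hx]; funext n; simp [seqDer]
  nprod_mem_left n x y hx := by
    rw [LinearMap.mem_ker] at hx ⊢
    rw [freeAct_nprod, hx]; funext n; simp [seqProd]
  nprod_mem_right n x y hy := by
    rw [LinearMap.mem_ker] at hy ⊢
    rw [freeAct_nprod, hy]; funext n; simp [seqProd]
  der_nprod n x y := by
    rw [LinearMap.mem_ker, map_sub, sub_eq_zero, map_neg, map_nsmul]
    simp only [freeAct_nprod, freeAct_der, seqProd_seqDer_left]
  nprod_der n x y := by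
    rw [LinearMap.mem_ker, map_sub, sub_eq_zero, map_add, map_nsmul]
    simp only [freeAct_nprod, freeAct_der, seqProd_seqDer_right]
  assoc n m x y z := by
    rw [LinearMap.mem_ker, map_sub, sub_eq_zero, map_sum]
    simp only [map_nsmul, freeAct_nprod]
    exact seqProd_assoc n m _ _ _
  locality n hn := by
    obtain ⟨m, rfl⟩ := Nat.exists_eq_add_of_le' hn
    rw [LinearMap.mem_ker, freeAct_nprod, FreeOp.v, freeAct_single, wordAct, virAct_zero]
    exact seqProd_two_weyl (derivative_mul_mulLeft α) m 0 0
  vir_zero := by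
    rw [LinearMap.mem_ker, sub_sub_cancel, map_sub, freeAct_der, freeAct_nprod, freeAct_der,
      FreeOp.v, freeAct_single, wordAct, virAct_zero,
      seqProd_one_weyl (derivative_mul_mulLeft α) 0 0, sub_self]
  vir_one := by
    rw [LinearMap.mem_ker, map_sub, map_add, map_nsmul, freeAct_nprod,
      FreeOp.v, freeAct_single, wordAct, virAct_zero,
      seqProd_one_weyl (derivative_mul_mulLeft α) 0 0, two_nsmul]
    exact sub_self _

/-- The action of `U(2)` on `M_(α,0)`: the generator `v` acts by `v_(λ) u = (∂ + α) u`. -/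
def U2.seqAct : U2 k →ₗ[k] (ℕ → Module.End k k[X]) :=
  (FreeOp.relations k).liftQ (freeAct α) (sInf_le (ker_freeAct_isAdmissible α))

theorem U2.seqAct_mk (x : FreeOp k) : U2.seqAct α (U2.mk k x) = freeAct α x := rfl

theorem U2.seqAct_v : U2.seqAct α (U2.v k) = virAct α 0 := by
  rw [U2.v, U2.seqAct_mk, FreeOp.v, freeAct_single, wordAct]

theorem U2.seqAct_der (a : U2 k) : U2.seqAct α (U2.der k a) = seqDer (U2.seqAct α a) := by
  obtain ⟨x, rfl⟩ := U2.mk_surjective k a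
  rw [U2.der_mk, U2.seqAct_mk, U2.seqAct_mk, freeAct_der]

theorem U2.seqAct_nprod (m : ℕ) (a b : U2 k) :
    U2.seqAct α (U2.nprod k m a b) = seqProd m (U2.seqAct α a) (U2.seqAct α b) := by
  obtain ⟨x, rfl⟩ := U2.mk_surjective k a
  obtain ⟨y, rfl⟩ := U2.mk_surjective k b
  rw [U2.nprod_mk, U2.seqAct_mk, U2.seqAct_mk, U2.seqAct_mk, freeAct_nprod]

theorem sesqui_virAct : Sesqui (LinearMap.mulLeft k (X : k[X])) (virAct α 0) := by
  have h : ∀ n : ℕ, (derivative : Module.End k k[X]) ^ n * LinearMap.mulLeft k (X : k[X]) =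
      LinearMap.mulLeft k (X : k[X]) * derivative ^ n + n • derivative ^ (n - 1) := by
    intro n
    induction n with
    | zero => simp
    | succ n ih =>
      have h1 := derivative_mul_mulLeft (0 : k)
      rw [C_0, add_zero] at h1
      rw [pow_succ', mul_assoc, ih, mul_add, ← mul_assoc, h1, Nat.add_sub_cancel, add_mul, one_mul,
        mul_smul_comm]
      cases n with
      | zero => simp
      | succ n =>
        rw [Nat.add_sub_cancel, ← pow_succ', succ_nsmul (derivative ^ (n + 1)) (n + 1), mul_assoc]
        abel
  have hc : LinearMap.mulLeft k (X + C α) * LinearMap.mulLeft k (X : k[X]) =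
      LinearMap.mulLeft k (X : k[X]) * LinearMap.mulLeft k (X + C α) := by
    refine LinearMap.ext fun f => ?_
    simp only [Module.End.mul_apply, LinearMap.mulLeft_apply]
    ring
  funext n
  rw [virAct_zero]
  simp only [add_zero, seqDer, Pi.neg_apply, neg_neg]
  rw [mul_assoc, h, mul_add, ← mul_assoc, hc, mul_assoc, add_sub_cancel_left, mul_smul_comm]

theorem sesqui_wordAct (w : Word) : Sesqui (LinearMap.mulLeft k (X : k[X])) (wordAct α w) := by
  induction w with
  | v => exact sesqui_virAct α
  | der w ih => exact ih.seqDer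
  | nprod m w w' ih ih' => exact ih.seqProd ih' m

theorem wordAct_locality (w : Word) (f : k[X]) :
    ∃ N : ℕ, ∀ n : ℕ, N ≤ n → wordAct α w n f = 0 := by
  induction w with
  | v =>
    refine ⟨f.natDegree + 1, fun n hn => ?_⟩
    rw [wordAct, virAct_zero]
    simp only [add_zero, Module.End.mul_apply, Module.End.pow_apply]
    rw [iterate_derivative_eq_zero (by omega), map_zero]
  | der w ih =>
    obtain ⟨N, hN⟩ := ih
    refine ⟨N + 1, fun n hn => ?_⟩
    simp [wordAct, seqDer, hN (n - 1) (by omega)]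
  | nprod m w w' ih ih' =>
    obtain ⟨N, hN⟩ := ih'
    refine ⟨N, fun n hn => ?_⟩
    simp only [wordAct, seqProd, LinearMap.sum_apply, LinearMap.smul_apply, Module.End.mul_apply]
    refine Finset.sum_eq_zero fun p _ => ?_
    rw [hN (n + p.2) (by omega), map_zero, smul_zero, smul_zero]

theorem U2.seqAct_locality (a : U2 k) (f : k[X]) :
    ∃ N : ℕ, ∀ n : ℕ, N ≤ n → U2.seqAct α a n f = 0 := by
  obtain ⟨x, rfl⟩ := U2.mk_surjective k a
  rw [U2.seqAct_mk]
  induction x using Finsupp.induction_linear with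
  | zero => exact ⟨0, fun n _ => by simp⟩
  | add x y hx hy =>
    obtain ⟨N, hN⟩ := hx
    obtain ⟨N', hN'⟩ := hy
    refine ⟨N + N', fun n hn => ?_⟩
    rw [map_add, Pi.add_apply, LinearMap.add_apply, hN n (by omega), hN' n (by omega), add_zero]
  | single w c =>
    obtain ⟨N, hN⟩ := wordAct_locality α w f
    refine ⟨N, fun n hn => ?_⟩
    rw [← mul_one c, ← smul_eq_mul, ← Finsupp.smul_single, map_smul, freeAct_single,
      Pi.smul_apply, LinearMap.smul_apply, hN n hn, smul_zero]

theorem U2.seqAct_X_mul (n : ℕ) (a : U2 k) (f : k[X]) : U2.seqAct α a n (X * f) =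
    X * U2.seqAct α a n f + n • U2.seqAct α a (n - 1) f := by
  obtain ⟨x, rfl⟩ := U2.mk_surjective k a
  rw [U2.seqAct_mk]
  induction x using Finsupp.induction_linear with
  | zero => simp
  | add x y hx hy =>
    simp only [map_add, Pi.add_apply, LinearMap.add_apply, hx, hy, smul_add, mul_add]
    abel
  | single w c =>
    rw [← mul_one c, ← smul_eq_mul, ← Finsupp.smul_single, map_smul, freeAct_single]
    have h := LinearMap.congr_fun (congrFun (sesqui_wordAct α w) n) f
    simp only [seqDer, Pi.neg_apply, neg_neg, LinearMap.sub_apply, Module.End.mul_apply,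
      LinearMap.mulLeft_apply, LinearMap.smul_apply] at h
    rw [sub_eq_iff_eq_add] at h
    simp only [Pi.smul_apply, LinearMap.smul_apply, h, smul_add, mul_smul_comm]
    rw [add_comm, smul_comm]

theorem U2.seqAct_der_apply (n : ℕ) (a : U2 k) (f : k[X]) :
    U2.seqAct α (U2.der k a) n f = -(n • U2.seqAct α a (n - 1) f) := by
  rw [U2.seqAct_der, seqDer, LinearMap.neg_apply, LinearMap.smul_apply]

theorem U2.seqAct_seqAct (n m : ℕ) (a b : U2 k) (f : k[X]) :
    U2.seqAct α a n (U2.seqAct α b m f) = ∑ p ∈ antidiagonal n, n.choose p.1 •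
      U2.seqAct α (U2.nprod k p.1 a b) (m + p.2) f := by
  rw [← Module.End.mul_apply, mul_eq_sum_seqProd]
  simp only [U2.seqAct_nprod, LinearMap.sum_apply, LinearMap.smul_apply]

/-- The module `M_(α,0) = k[∂] u` with `v_(λ) u = (∂ + α) u`, as a space of polynomials in `∂`. -/
def MAlphaZero (_α : k) : Type _ := k[X]

instance : AddCommGroup (MAlphaZero α) := inferInstanceAs (AddCommGroup k[X])

instance : Module k (MAlphaZero α) := inferInstanceAs (Module k k[X])

instance : ConformalModule k (U2 k) (MAlphaZero α) where
  mder := (LinearMap.mulLeft k (X : k[X]) : k[X] →ₗ[k] k[X])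
  act n := ((LinearMap.proj n : (ℕ → Module.End k k[X]) →ₗ[k] Module.End k k[X]) ∘ₗ
    U2.seqAct α : U2 k →ₗ[k] k[X] →ₗ[k] k[X])
  act_locality := U2.seqAct_locality α
  der_act := U2.seqAct_der_apply α
  act_der := U2.seqAct_X_mul α
  act_assoc := U2.seqAct_seqAct α

end VirModule

theorem sum_antidiagonal_choose_left {V : Type*} [AddCommGroup V] (m : ℕ) (F : ℕ → ℕ → V) :
    ∑ p ∈ antidiagonal m, m.choose p.1 • (p.1 • F (p.1 - 1) p.2) =
      m • ∑ p ∈ antidiagonal (m - 1), (m - 1).choose p.1 • F p.1 p.2 := by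
  cases m with
  | zero => simp
  | succ m =>
    rw [Finset.Nat.sum_antidiagonal_succ, zero_smul, smul_zero, zero_add, Nat.add_sub_cancel,
      Finset.smul_sum]
    refine Finset.sum_congr rfl fun p _ => ?_
    rw [smul_smul, smul_smul, Nat.add_sub_cancel, ← Nat.add_one_mul_choose_eq]

theorem sum_antidiagonal_choose_right {V : Type*} [AddCommGroup V] (m : ℕ) (F : ℕ → ℕ → V) :
    ∑ p ∈ antidiagonal m, m.choose p.1 • (p.2 • F p.1 (p.2 - 1)) =
      m • ∑ p ∈ antidiagonal (m - 1), (m - 1).choose p.1 • F p.1 p.2 := by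
  have h := sum_antidiagonal_choose_left m (fun i j => F j i)
  rw [← Finset.Nat.sum_antidiagonal_swap, ← Finset.Nat.sum_antidiagonal_swap (n := m - 1)] at h
  simp only [Prod.fst_swap, Prod.snd_swap] at h
  refine (Finset.sum_congr rfl fun p hp => ?_).trans (h.trans ?_)
  · rw [← Nat.choose_symm_of_eq_add (HasAntidiagonal.mem_antidiagonal.1 hp).symm]
  · congr 1
    refine Finset.sum_congr rfl fun p hp => ?_
    rw [← Nat.choose_symm_of_eq_add (HasAntidiagonal.mem_antidiagonal.1 hp).symm]

/-! ### The algebra `A_+(C)` -/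

section APlus

open AssocConformalAlgebra ConformalModule

variable (k : Type*) (C : Type*) [Field k] [AddCommGroup C] [Module k C]
  [AssocConformalAlgebra k C]

/-- The relations `(∂a)(n) = -n a(n-1)` of `A_+(C)`. -/
def APlus.relations : Submodule k (ℕ →₀ C) :=
  Submodule.span k {x | ∃ (n : ℕ) (a : C),
    x = Finsupp.single n (der (k := k) a) + n • Finsupp.single (n - 1) a}

/-- The space `A_+(C)`, spanned by the elements `a(n)`, `a ∈ C`, `n ≥ 0`, which are linear in `a`
and satisfy `(∂a)(n) = -n a(n-1)`. -/
def APlus : Type _ := (ℕ →₀ C) ⧸ APlus.relations k C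

namespace APlus

instance : AddCommGroup (APlus k C) := inferInstanceAs (AddCommGroup ((ℕ →₀ C) ⧸ relations k C))

instance : Module k (APlus k C) := inferInstanceAs (Module k ((ℕ →₀ C) ⧸ relations k C))

/-- `coef k C n a` is the element `a(n)` of `A_+(C)`. -/
def coef (n : ℕ) : C →ₗ[k] APlus k C := (relations k C).mkQ ∘ₗ Finsupp.lsingle n

variable {k C}

theorem coef_der (n : ℕ) (a : C) :
    coef k C n (der (k := k) a) = -(n • coef k C (n - 1) a) := by
  rw [eq_neg_iff_add_eq_zero]
  have h := (Submodule.Quotient.mk_eq_zero (relations k C)).2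
    (Submodule.subset_span ⟨n, a, rfl⟩)
  exact h

variable {V : Type*} [AddCommGroup V] [Module k V]

/-- A linear map on `A_+(C)` is given by linear maps `f n : a(n) ↦ f n a` which respect the
relations. -/
def lift (f : ℕ → C →ₗ[k] V)
    (hf : ∀ (n : ℕ) (a : C), f n (der (k := k) a) = -(n • f (n - 1) a)) : APlus k C →ₗ[k] V :=
  (relations k C).liftQ (Finsupp.lsum k f) (Submodule.span_le.2 (by
    rintro x ⟨n, a, rfl⟩
    rw [SetLike.mem_coe, LinearMap.mem_ker, map_add, map_nsmul, Finsupp.lsum_single,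
      Finsupp.lsum_single, hf, neg_add_cancel]))

@[simp]
theorem lift_coef (f : ℕ → C →ₗ[k] V)
    (hf : ∀ (n : ℕ) (a : C), f n (der (k := k) a) = -(n • f (n - 1) a)) (n : ℕ) (a : C) :
    lift f hf (coef k C n a) = f n a :=
  Finsupp.lsum_single k f n a

theorem hom_ext {f g : APlus k C →ₗ[k] V} (h : ∀ n a, f (coef k C n a) = g (coef k C n a)) :
    f = g := by
  refine Submodule.linearMap_qext _ (Finsupp.lhom_ext fun n a => h n a)

variable (k C)

/-- The derivation `∂` of `A_+(C)`: `∂(a(n)) = -n a(n-1)`. -/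
def deriv : APlus k C →ₗ[k] APlus k C :=
  lift (fun n => -(n • coef k C (n - 1))) (fun n a => by
    simp only [LinearMap.neg_apply, LinearMap.smul_apply, coef_der])

/-- The product `a(m) b(n) = ∑ s, choose m s * (a_(s) b)(m + n - s)`, with `a(m)` fixed. -/
def mulCoef (m : ℕ) (a : C) : APlus k C →ₗ[k] APlus k C :=
  lift (fun n => ∑ p ∈ antidiagonal m, m.choose p.1 • (coef k C (p.2 + n) ∘ₗ nprod p.1 a))
    (fun n b => by
      simp only [LinearMap.sum_apply, LinearMap.smul_apply, LinearMap.comp_apply, nprod_der,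
        map_add, coef_der, map_nsmul, smul_add, Finset.sum_add_distrib]
      rw [sum_antidiagonal_choose_left m (fun s r => coef k C (r + n) (nprod s a b)),
        ← sum_antidiagonal_choose_right m (fun s r => coef k C (r + n) (nprod s a b)),
        ← Finset.sum_add_distrib, Finset.smul_sum, ← Finset.sum_neg_distrib]
      refine Finset.sum_congr rfl fun p _ => ?_
      rw [← smul_add, smul_comm n]
      have h1 : n • coef k C (p.2 + n - 1) (nprod (k := k) p.1 a b) =
          n • coef k C (p.2 + (n - 1)) (nprod (k := k) p.1 a b) := by
        rcases Nat.eq_zero_or_pos n with rfl | hn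
        · simp
        · rw [Nat.add_sub_assoc hn]
      have h2 : p.2 • coef k C (p.2 + n - 1) (nprod (k := k) p.1 a b) =
          p.2 • coef k C (p.2 - 1 + n) (nprod (k := k) p.1 a b) := by
        rcases Nat.eq_zero_or_pos p.2 with h | h
        · simp [h]
        · rw [Nat.sub_add_comm h]
      rw [add_smul, h1, h2, neg_add, add_right_comm, neg_add_cancel, zero_add, smul_neg])

theorem mulCoef_coef (m n : ℕ) (a b : C) : mulCoef k C m a (coef k C n b) =
    ∑ p ∈ antidiagonal m, m.choose p.1 • coef k C (p.2 + n) (nprod (k := k) p.1 a b) := by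
  simp [mulCoef]

/-- The multiplication of the associative algebra `A_+(C)`. -/
def mul : APlus k C →ₗ[k] APlus k C →ₗ[k] APlus k C :=
  lift
    (fun m =>
      { toFun := mulCoef k C m
        map_add' := fun a a' => hom_ext fun n b => by
          simp only [LinearMap.add_apply, mulCoef_coef, map_add, smul_add,
            Finset.sum_add_distrib]
        map_smul' := fun c a => hom_ext fun n b => by
          simp only [LinearMap.smul_apply, mulCoef_coef, map_smul, RingHom.id_apply,
            Finset.smul_sum]
          exact Finset.sum_congr rfl fun p _ => smul_comm _ _ _ })
    (fun m a => hom_ext fun n b => by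
      simp only [LinearMap.coe_mk, AddHom.coe_mk, LinearMap.neg_apply, LinearMap.smul_apply,
        mulCoef_coef, der_nprod, map_neg, map_nsmul, smul_neg, Finset.sum_neg_distrib]
      rw [sum_antidiagonal_choose_left m (fun s r => coef k C (r + n) (nprod s a b))])

theorem mul_coef_coef (m n : ℕ) (a b : C) : mul k C (coef k C m a) (coef k C n b) =
    ∑ p ∈ antidiagonal m, m.choose p.1 • coef k C (p.2 + n) (nprod (k := k) p.1 a b) := by
  rw [← mulCoef_coef]
  exact LinearMap.congr_fun (lift_coef _ _ m a) _

variable (M : Type*) [AddCommGroup M] [Module k M] [ConformalModule k C M]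

/-- A conformal module `M` over `C` as a left module over `A_+(C)`: `a(n) u = a_(n) u`. -/
def toEnd : APlus k C →ₗ[k] M →ₗ[k] M :=
  lift (ConformalModule.act (k := k) (C := C) (M := M))
    (fun n a => LinearMap.ext fun u => ConformalModule.der_act n a u)

end APlus

end APlus

/-! ### Hochschild cochains -/

section Hochschild

variable {k A M : Type*} [Field k] [AddCommGroup A] [Module k A] [AddCommGroup M] [Module k M]

/-- The space of Hochschild `n`-cochains of `A` with values in `M`. -/
abbrev Cochain (k A M : Type*) [Field k] [AddCommGroup A] [Module k A] [AddCommGroup M]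
    [Module k M] (n : ℕ) : Type _ := MultilinearMap k (fun _ : Fin n => A) M

theorem contractNth_update (mul : A →ₗ[k] A →ₗ[k] A) {n : ℕ} (j : Fin n) (a : Fin (n + 1) → A)
    (i : Fin (n + 1)) : ∃ (i' : Fin n) (ℓ : A →ₗ[k] A), ∀ x : A,
      Fin.contractNth j.castSucc (fun x y => mul x y) (Function.update a i x) =
        Function.update (Fin.contractNth j.castSucc (fun x y => mul x y) a) i' (ℓ x) := by
  rcases lt_trichotomy (i : ℕ) j with h | h | h
  · refine ⟨⟨i, by omega⟩, LinearMap.id, fun x => ?_⟩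
    funext r
    simp only [Fin.contractNth, Function.update_apply, Fin.ext_iff, Fin.val_castSucc, Fin.val_succ,
      LinearMap.id_apply]
    split_ifs <;> first | rfl | omega
  · refine ⟨j, mul.flip (a j.succ), fun x => ?_⟩
    funext r
    simp only [Fin.contractNth, Function.update_apply, Fin.ext_iff, Fin.val_castSucc, Fin.val_succ,
      LinearMap.flip_apply]
    split_ifs <;> first | rfl | omega | skip
    rw [show r = j from Fin.ext ‹_›]
  · rcases Nat.lt_or_ge (j + 1) i with h' | h'
    · refine ⟨⟨i - 1, by omega⟩, LinearMap.id, fun x => ?_⟩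
      funext r
      simp only [Fin.contractNth, Function.update_apply, Fin.ext_iff, Fin.val_castSucc,
        Fin.val_succ, LinearMap.id_apply]
      split_ifs <;> first | rfl | omega
    · refine ⟨j, mul (a j.castSucc), fun x => ?_⟩
      funext r
      simp only [Fin.contractNth, Function.update_apply, Fin.ext_iff, Fin.val_castSucc,
        Fin.val_succ]
      split_ifs <;> first | rfl | omega | skip
      rw [show r = j from Fin.ext ‹_›]

/-- The cochain `(a_0, …, a_n) ↦ φ(a_0, …, a_j a_{j+1}, …, a_n)`. -/
def contractTerm (mul : A →ₗ[k] A →ₗ[k] A) {n : ℕ} (j : Fin n) :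
    Cochain k A M n →ₗ[k] Cochain k A M (n + 1) where
  toFun φ := MultilinearMap.mk' (fun a => φ (Fin.contractNth j.castSucc (fun x y => mul x y) a))
    (fun a i x y => by
      obtain ⟨i', ℓ, h⟩ := contractNth_update mul j a i
      rw [h, h, h, map_add, φ.map_update_add])
    (fun a i c x => by
      obtain ⟨i', ℓ, h⟩ := contractNth_update mul j a i
      rw [h, h, map_smul, φ.map_update_smul])
  map_add' _ _ := rfl
  map_smul' _ _ := rfl

/-- The cochain `(a_0, …, a_n) ↦ a_0 φ(a_1, …, a_n)`. -/
def leftTerm (L : A →ₗ[k] M →ₗ[k] M) (n : ℕ) :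
    Cochain k A M n →ₗ[k] Cochain k A M (n + 1) where
  toFun φ := MultilinearMap.mk' (fun a => L (a 0) (φ (Fin.tail a)))
    (fun a i x y => by
      induction i using Fin.cases with
      | zero => simp [Fin.tail_update_zero]
      | succ i =>
        simp [Fin.tail_update_succ, Function.update_of_ne (Fin.succ_ne_zero i).symm])
    (fun a i c x => by
      induction i using Fin.cases with
      | zero => simp [Fin.tail_update_zero]
      | succ i =>
        simp [Fin.tail_update_succ, Function.update_of_ne (Fin.succ_ne_zero i).symm])
  map_add' _ _ := by ext; simp
  map_smul' _ _ := by ext; simp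

/-- The cochain `(a_0, …, a_n) ↦ φ(a_0, …, a_{n-1}) a_n`. -/
def rightTerm (R : A →ₗ[k] M →ₗ[k] M) (n : ℕ) :
    Cochain k A M n →ₗ[k] Cochain k A M (n + 1) where
  toFun φ := MultilinearMap.mk' (fun a => R (a (Fin.last n)) (φ (Fin.init a)))
    (fun a i x y => by
      induction i using Fin.lastCases with
      | last => simp [Fin.init_update_last]
      | cast i =>
        simp [Fin.init_update_castSucc, Function.update_of_ne (Fin.castSucc_lt_last i).ne'])
    (fun a i c x => by
      induction i using Fin.lastCases with
      | last => simp [Fin.init_update_last]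
      | cast i =>
        simp [Fin.init_update_castSucc, Function.update_of_ne (Fin.castSucc_lt_last i).ne'])
  map_add' _ _ := by ext; simp
  map_smul' _ _ := by ext; simp

/-- The Hochschild differential of an associative algebra `A` with values in a bimodule `M`, with
left action `a u = L a u` and right action `u a = R a u`:
`(dφ)(a_0, …, a_n) = a_0 φ(a_1, …, a_n) + ∑_{j<n} (-1)^(j+1) φ(…, a_j a_{j+1}, …)
  + (-1)^(n+1) φ(a_0, …, a_{n-1}) a_n`. -/
def hochschildD (mul : A →ₗ[k] A →ₗ[k] A) (L R : A →ₗ[k] M →ₗ[k] M) (n : ℕ) :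
    Cochain k A M n →ₗ[k] Cochain k A M (n + 1) :=
  leftTerm L n + ∑ j : Fin n, (-1 : k) ^ ((j : ℕ) + 1) • contractTerm mul j +
    (-1 : k) ^ (n + 1) • rightTerm R n

/-- The operator `(Dφ)(a_1, …, a_n) = ∂ φ(a_1, …, a_n) - ∑_i φ(a_1, …, ∂a_i, …, a_n)`. -/
def cochainDer (dA : A →ₗ[k] A) (dM : M →ₗ[k] M) (n : ℕ) :
    Cochain k A M n →ₗ[k] Cochain k A M n where
  toFun φ := dM.compMultilinearMap φ -
    ∑ i : Fin n, φ.compLinearMap (fun j => if j = i then dA else LinearMap.id)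
  map_add' φ ψ := by
    ext a
    simp only [sub_apply, add_apply, _root_.sum_apply,
      MultilinearMap.compLinearMap_apply, LinearMap.compMultilinearMap_apply, map_add,
      Finset.sum_add_distrib]
    abel
  map_smul' c φ := by
    ext a
    simp only [sub_apply, smul_apply, _root_.sum_apply,
      MultilinearMap.compLinearMap_apply, LinearMap.compMultilinearMap_apply, map_smul,
      RingHom.id_apply, smul_sub, Finset.smul_sum]

end Hochschild

/-! ### Hochschild cohomology of a conformal algebra -/

section Cohomology

variable (k C M : Type*) [Field k] [AddCommGroup C] [Module k C] [AssocConformalAlgebra k C]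
  [AddCommGroup M] [Module k M] [ConformalModule k C M]

/-- The space `C̃^n(C, M)` of basic (non-reduced) Hochschild `n`-cochains: the Hochschild cochains of
the associative algebra `A_+(C)` with values in `M`. -/
abbrev BasicCochain (n : ℕ) : Type _ := Cochain k (APlus k C) M n

/-- The Hochschild differential `d : C̃^n(C, M) → C̃^(n+1)(C, M)`, where the left conformal module
`M` is considered as a bimodule with zero right action. -/
def basicD (n : ℕ) : BasicCochain k C M n →ₗ[k] BasicCochain k C M (n + 1) :=
  hochschildD (APlus.mul k C) (APlus.toEnd k C M) 0 n

/-- The operator `D^n` on `C̃^n(C, M)` induced by the operators `∂` on `M` and on `A_+(C)`. -/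
def basicDer (n : ℕ) : BasicCochain k C M n →ₗ[k] BasicCochain k C M n :=
  cochainDer (APlus.deriv k C) (ConformalModule.mder (k := k) C) n

/-- The local basic cochains: for fixed `a_1, …, a_n ∈ C`, only finitely many of the values
`φ(a_1(m_1), …, a_n(m_n))` are non-zero. They are the same as the sesqui-linear maps
`φ_(λ_1,…,λ_n) : C^{⊗n} → M[λ_1, …, λ_n]`,
`φ_(λ_1,…,λ_n)(a_1, …, a_n) = ∑ λ_1^{m_1}/m_1! ⋯ λ_n^{m_n}/m_n! φ(a_1(m_1), …, a_n(m_n))`. -/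
def localCochains (n : ℕ) : Submodule k (BasicCochain k C M n) where
  carrier := {φ | ∀ a : Fin n → C, ∃ N : ℕ, ∀ m : Fin n → ℕ, (∃ i, N ≤ m i) →
    φ (fun i => APlus.coef k C (m i) (a i)) = 0}
  add_mem' := by
    intro φ ψ hφ hψ a
    obtain ⟨N, hN⟩ := hφ a
    obtain ⟨N', hN'⟩ := hψ a
    refine ⟨N + N', fun m ⟨i, hi⟩ => ?_⟩
    rw [add_apply, hN m ⟨i, by omega⟩, hN' m ⟨i, by omega⟩, add_zero]
  zero_mem' := fun a => ⟨0, fun m _ => rfl⟩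
  smul_mem' := by
    intro c φ hφ a
    obtain ⟨N, hN⟩ := hφ a
    refine ⟨N, fun m hm => ?_⟩
    rw [smul_apply, hN m hm, smul_zero]

variable {k C M}

/-- Let `S^•` be a subcomplex of `C̃^•(C, M)` stable under `D`. The preimage in `S^n` of the space of
`n`-cocycles of the reduced complex `S^• / D S^•`. -/
def reducedCocycles (S : ∀ n, Submodule k (BasicCochain k C M n)) (n : ℕ) :
    Submodule k (BasicCochain k C M n) :=
  S n ⊓ ((S (n + 1)).map (basicDer k C M (n + 1))).comap (basicD k C M n)

/-- The preimage in `S^n` of the space of `n`-coboundaries of the reduced complex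
`S^• / D S^•`. -/
def reducedCoboundaries (S : ∀ n, Submodule k (BasicCochain k C M n)) :
    ∀ n : ℕ, Submodule k (BasicCochain k C M n)
  | 0 => (S 0).map (basicDer k C M 0)
  | n + 1 => (S n).map (basicD k C M n) ⊔ (S (n + 1)).map (basicDer k C M (n + 1))

/-- The `n`-th cohomology space of the reduced complex `S^• / D S^•`. -/
abbrev ReducedCohomology (S : ∀ n, Submodule k (BasicCochain k C M n)) (n : ℕ) : Type _ :=
  reducedCocycles S n ⧸ (reducedCoboundaries S n).submoduleOf (reducedCocycles S n)

variable (k C M)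

/-- The Hochschild cohomology `H^n(C, M)`: the cohomology of the reduced complex
`C̃^•(C, M) / D C̃^•(C, M)` built on all basic cochains. -/
abbrev HochschildCohomology (n : ℕ) : Type _ :=
  ReducedCohomology (k := k) (C := C) (M := M) (fun _ => ⊤) n

/-- The Hochschild cohomology `H^n(C, M)` computed by means of local (polynomial) cochains. -/
abbrev LocalHochschildCohomology (n : ℕ) : Type _ :=
  ReducedCohomology (localCochains k C M) n

end Cohomology

end Conformal

end

/-!
The algebra `A_+(U(2))` is the right ideal `q W` of the Weyl algebra `W = k⟨q, t⟩`, `t q - q t = 1`,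
with `v(n) = q t ^ n`. Right multiplication by elements of `W` is left `q W`-linear, and every
`x ∈ q W` satisfies `x = (x t) q - x (q t)` with `q, q t ∈ q W`. Hence `q W` is a projective left
module over itself, and the Hochschild complex of `q W` with values in any left module, with zero
right action, is exact in degrees `≥ 2`. Explicitly,
`(sφ)(x_1, …, x_n) = φ(x_1, …, x_n t, q) - φ(x_1, …, x_n, q t)`
satisfies `s d - d s = ± id` (`homotopy_hochschildD`). Since `∂ t = -1`, `∂ q = 0` and
`∂ (q t) = -q`, the element `t ⊗ q - 1 ⊗ q t` is annihilated by `∂`, so that `s` commutes with `D`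
(`homotopy_cochainDer`) and descends to the reduced complex. It also preserves locality
(`u2Homotopy_mem_localCochains`).

The structure of `U(2)` is not needed for this, only the right multiplication by `t`. On
`A_+(U(2))` it is `a(n) ↦ a(n + 1) + (ρ a)(n)` (`APlus.rightT`), where `ρ` is the operator on `U(2)`
with `ρ v = 0`, `ρ (∂a) = ∂(ρ a) + a` and `ρ (a_(n) b) = a_(n) (ρ b)`, which is defined on the free
algebra and preserves the relations. The identity `x = (x t) q - x (q t)` is checked for
`x = v(n)`, and propagates to all `x` because the elements satisfying it form a left ideal
(`APlus.rightT_mul_sub`).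
-/

noncomputable section

open Finset

namespace Conformal

/-! ### The operator `ρ` on `U(2)` -/

section RightT

variable (k : Type*) [Field k]

/-- The operator `ρ` on words: `ρ v = 0`, `ρ (∂w) = ∂(ρ w) + w`, `ρ (w_(n) w') = w_(n) (ρ w')`. -/
def wordRho : Word → FreeOp k
  | Word.v => 0
  | Word.der w => FreeOp.der k (wordRho w) + Finsupp.single w 1
  | Word.nprod n w w' => FreeOp.nprod k n (Finsupp.single w 1) (wordRho w')

/-- The operator `ρ` on the free algebra. -/
def freeRho : FreeOp k →ₗ[k] FreeOp k := Finsupp.linearCombination k (wordRho k)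

variable {k}

theorem freeRho_single (w : Word) : freeRho k (Finsupp.single w 1) = wordRho k w := by
  simp [freeRho]

theorem freeRho_v : freeRho k (FreeOp.v k) = 0 := by
  rw [FreeOp.v, freeRho_single, wordRho]

theorem freeRho_der (x : FreeOp k) :
    freeRho k (FreeOp.der k x) = FreeOp.der k (freeRho k x) + x := by
  induction x using Finsupp.induction_linear with
  | zero => simp
  | add x y hx hy => simp only [map_add, hx, hy]; abel
  | single w c =>
    rw [← mul_one c, ← smul_eq_mul, ← Finsupp.smul_single, map_smul, map_smul, map_smul, map_smul,
      U2.freeOp_der_single, freeRho_single, freeRho_single, wordRho, smul_add]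

theorem freeRho_nprod (n : ℕ) (x y : FreeOp k) :
    freeRho k (FreeOp.nprod k n x y) = FreeOp.nprod k n x (freeRho k y) := by
  induction x using Finsupp.induction_linear with
  | zero => simp
  | add x x' hx hx' => simp only [map_add, LinearMap.add_apply, hx, hx']
  | single w c =>
    induction y using Finsupp.induction_linear with
    | zero => simp
    | add y y' hy hy' => simp only [map_add, hy, hy']
    | single w' c' =>
      rw [← mul_one c, ← mul_one c', ← smul_eq_mul, ← smul_eq_mul, ← Finsupp.smul_single,
        ← Finsupp.smul_single]
      simp only [map_smul, LinearMap.smul_apply]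
      rw [U2.freeOp_nprod_single, freeRho_single, freeRho_single, wordRho]

/-- The relations of `U(2)` are preserved by `ρ`, by minimality of the ideal of relations. -/
theorem relations_inf_comap_freeRho_isAdmissible [CharZero k] : FreeOp.IsAdmissible k
    (FreeOp.relations k ⊓ (FreeOp.relations k).comap (freeRho k)) := by
  have hr := FreeOp.relations_isAdmissible k
  -- `v_(1) v = v`, since `2` is invertible
  have hv : FreeOp.nprod k 1 (FreeOp.v k) (FreeOp.v k) - FreeOp.v k ∈ FreeOp.relations k := by
    have h := (FreeOp.relations k).smul_mem (2⁻¹ : k) hr.vir_one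
    rw [← two_nsmul, ← Nat.cast_smul_eq_nsmul k, ← Nat.cast_smul_eq_nsmul k, ← smul_sub, smul_smul,
      Nat.cast_ofNat, inv_mul_cancel₀ two_ne_zero, one_smul] at h
    exact h
  refine ⟨fun x hx => ⟨hr.der_mem x hx.1, ?_⟩, fun n x y hx => ⟨hr.nprod_mem_left n x y hx.1, ?_⟩,
    fun n x y hy => ⟨hr.nprod_mem_right n x y hy.1, ?_⟩, fun n x y => ⟨hr.der_nprod n x y, ?_⟩,
    fun n x y => ⟨hr.nprod_der n x y, ?_⟩, fun n m x y z => ⟨hr.assoc n m x y z, ?_⟩,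
    fun n hn => ⟨hr.locality n hn, ?_⟩, ⟨hr.vir_zero, ?_⟩, ⟨hr.vir_one, ?_⟩⟩
  · rw [SetLike.mem_coe, Submodule.mem_comap, freeRho_der]
    exact add_mem (hr.der_mem _ hx.2) hx.1
  · rw [SetLike.mem_coe, Submodule.mem_comap, freeRho_nprod]
    exact hr.nprod_mem_left n _ _ hx.1
  · rw [SetLike.mem_coe, Submodule.mem_comap, freeRho_nprod]
    exact hr.nprod_mem_right n _ _ hy.2
  · simp only [SetLike.mem_coe, Submodule.mem_comap, map_sub, map_neg, map_nsmul, freeRho_nprod]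
    exact hr.der_nprod n x _
  · simp only [SetLike.mem_coe, Submodule.mem_comap, map_sub, map_add, map_nsmul, freeRho_nprod, freeRho_der]
    convert hr.nprod_der n x (freeRho k y) using 1
    abel
  · simp only [SetLike.mem_coe, Submodule.mem_comap, map_sub, map_sum, map_nsmul, freeRho_nprod]
    exact hr.assoc n m x y _
  · rw [SetLike.mem_coe, Submodule.mem_comap, freeRho_nprod, freeRho_v, map_zero]
    exact zero_mem _
  · rw [SetLike.mem_coe, Submodule.mem_comap, sub_sub_cancel, map_sub, freeRho_der, freeRho_der, freeRho_nprod,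
      freeRho_v, map_zero, map_zero, zero_add, zero_add]
    exact hv
  · simp [freeRho_nprod, freeRho_v]

namespace U2

variable (k)

/-- Induction over `U(2)`: it is the smallest subspace containing `v` and closed under `∂` and
all `n`-products. -/
theorem submodule_eq_top (P : Submodule k (U2 k)) (hv : v k ∈ P) (hd : ∀ a ∈ P, der k a ∈ P)
    (hn : ∀ (n : ℕ) (a b : U2 k), a ∈ P → b ∈ P → nprod k n a b ∈ P) : P = ⊤ := by
  have hw : ∀ w : Word, mk k (Finsupp.single w 1) ∈ P := by
    intro w
    induction w with
    | v => exact hv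
    | der w ih => rw [← freeOp_der_single, ← der_mk]; exact hd _ ih
    | nprod n w w' ih ih' =>
      rw [← freeOp_nprod_single, ← nprod_mk]; exact hn n _ _ ih ih'
  refine eq_top_iff.2 fun a _ => ?_
  obtain ⟨x, rfl⟩ := mk_surjective k a
  induction x using Finsupp.induction_linear with
  | zero => simp
  | add x y hx hy => rw [map_add]; exact add_mem (hx trivial) (hy trivial)
  | single w c =>
    rw [← mul_one c, ← smul_eq_mul, ← Finsupp.smul_single, map_smul]
    exact P.smul_mem c (hw w)

variable [CharZero k]

/-- The operator `ρ` on `U(2)`: `ρ v = 0`, `ρ (∂a) = ∂(ρ a) + a`, `ρ (a_(n) b) = a_(n) (ρ b)`.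
If `U(2)` is identified with `x k[∂, x]`, `v = x`, this is the partial derivative in `∂`. -/
def rho : U2 k →ₗ[k] U2 k :=
  (FreeOp.relations k).mapQ (FreeOp.relations k) (freeRho k)
    ((sInf_le relations_inf_comap_freeRho_isAdmissible : FreeOp.relations k ≤ _).trans
      inf_le_right)

theorem rho_mk (x : FreeOp k) : rho k (mk k x) = mk k (freeRho k x) := rfl

theorem rho_v : rho k (v k) = 0 := by
  rw [v, rho_mk, freeRho_v, map_zero]

theorem rho_der (a : U2 k) : rho k (der k a) = der k (rho k a) + a := by
  obtain ⟨x, rfl⟩ := mk_surjective k a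
  rw [der_mk, rho_mk, freeRho_der, map_add, rho_mk, der_mk]

theorem rho_nprod (n : ℕ) (a b : U2 k) : rho k (nprod k n a b) = nprod k n a (rho k b) := by
  obtain ⟨x, rfl⟩ := mk_surjective k a
  obtain ⟨y, rfl⟩ := mk_surjective k b
  rw [nprod_mk, rho_mk, freeRho_nprod, rho_mk, nprod_mk]

theorem v_nprod_one_v : nprod k 1 (v k) (v k) = v k := by
  have h : nprod k 1 (v k) (v k) + nprod k 1 (v k) (v k) = (2 : ℕ) • v k :=
    (mk_eq_mk k).2 (FreeOp.relations_isAdmissible k).vir_one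
  rw [← two_nsmul, ← Nat.cast_smul_eq_nsmul k, ← Nat.cast_smul_eq_nsmul k] at h
  exact smul_right_injective _ (by simp) h

end U2

end RightT

/-! ### The algebra `A_+(U(2))` -/

/-- The combination of the associativity identity of `n`-products with Vandermonde's identity which
makes `A_+(C)` associative. -/
theorem sum_antidiagonal_choose_assoc {V : Type*} [AddCommGroup V] (m n : ℕ)
    (G : ℕ → ℕ → ℕ → V) :
    ∑ i ∈ antidiagonal m, m.choose i.1 • ∑ j ∈ antidiagonal n, n.choose j.1 •
      ∑ l ∈ antidiagonal i.1, i.1.choose l.1 • G l.1 (j.1 + l.2) (i.2 + j.2) =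
    ∑ l ∈ antidiagonal m, m.choose l.1 • ∑ r ∈ antidiagonal (l.2 + n), (l.2 + n).choose r.1 •
      G l.1 r.1 r.2 := by
  have hs : ∀ (m : ℕ) (F : ℕ → ℕ → V), ∑ p ∈ antidiagonal (m + 1), (m + 1).choose p.1 • F p.1 p.2 =
      ∑ p ∈ antidiagonal m, m.choose p.1 • F p.1 (p.2 + 1) +
        ∑ p ∈ antidiagonal m, m.choose p.1 • F (p.1 + 1) p.2 := by
    intro m F
    rw [Finset.sum_antidiagonal_choose_succ_nsmul F m]
    congr 1
    refine Finset.sum_congr rfl fun p hp => ?_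
    rw [← Nat.choose_symm_of_eq_add (HasAntidiagonal.mem_antidiagonal.1 hp).symm]
  induction m generalizing G with
  | zero => simp
  | succ m ih =>
    rw [hs m (fun i i' => ∑ j ∈ antidiagonal n, n.choose j.1 •
      ∑ l ∈ antidiagonal i, i.choose l.1 • G l.1 (j.1 + l.2) (i' + j.2)),
      hs m (fun l l' => ∑ r ∈ antidiagonal (l' + n), (l' + n).choose r.1 • G l r.1 r.2)]
    have h1 : ∀ i j i' : ℕ, ∑ l ∈ antidiagonal (i + 1), (i + 1).choose l.1 • G l.1 (j + l.2) i' =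
        ∑ l ∈ antidiagonal i, i.choose l.1 • G l.1 (j + l.2 + 1) i' +
          ∑ l ∈ antidiagonal i, i.choose l.1 • G (l.1 + 1) (j + l.2) i' :=
      fun i j i' => hs i (fun l l' => G l (j + l') i')
    have h2 : ∀ l l' : ℕ, ∑ r ∈ antidiagonal (l' + 1 + n), (l' + 1 + n).choose r.1 • G l r.1 r.2 =
        ∑ r ∈ antidiagonal (l' + n), (l' + n).choose r.1 • G l r.1 (r.2 + 1) +
          ∑ r ∈ antidiagonal (l' + n), (l' + n).choose r.1 • G l (r.1 + 1) r.2 := by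
      intro l l'
      rw [Nat.add_right_comm]
      exact hs _ _
    simp only [h1, h2, smul_add, Finset.sum_add_distrib]
    rw [← ih (fun l r s => G l r (s + 1)), ← ih (fun l r s => G l (r + 1) s),
      ← ih (fun l r s => G (l + 1) r s)]
    simp only [Nat.add_right_comm _ 1]
    abel

namespace APlus

section General

variable {k C : Type*} [Field k] [AddCommGroup C] [Module k C] [AssocConformalAlgebra k C]

open AssocConformalAlgebra

theorem mul_assoc (x y z : APlus k C) :
    mul k C x (mul k C y z) = mul k C (mul k C x y) z := by
  have h : ∀ (m n p : ℕ) (a b c : C), mul k C (coef k C m a) (mul k C (coef k C n b)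
      (coef k C p c)) = mul k C (mul k C (coef k C m a) (coef k C n b)) (coef k C p c) := by
    intro m n p a b c
    simp only [mul_coef_coef, map_sum, map_nsmul, LinearMap.sum_apply, LinearMap.smul_apply]
    have h := sum_antidiagonal_choose_assoc m n
      (fun l r s => coef k C (s + p) (nprod (k := k) r (nprod (k := k) l a b) c))
    simp only [← add_assoc]
    refine Eq.trans ?_ h
    simp only [AssocConformalAlgebra.assoc, map_sum, map_nsmul, Finset.smul_sum, add_assoc]
    rw [Finset.sum_comm]
    refine Finset.sum_congr rfl fun i _ => Finset.sum_congr rfl fun j _ =>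
      Finset.sum_congr rfl fun l _ => ?_
    rw [smul_comm]
  have hz : ∀ (m n : ℕ) (a b : C) (z : APlus k C), mul k C (coef k C m a)
      (mul k C (coef k C n b) z) = mul k C (mul k C (coef k C m a) (coef k C n b)) z :=
    fun m n a b z => LinearMap.congr_fun (hom_ext (h m n · a b ·) : mul k C (coef k C m a) ∘ₗ
      mul k C (coef k C n b) = mul k C (mul k C (coef k C m a) (coef k C n b))) z
  have hy : ∀ (m : ℕ) (a : C) (y z : APlus k C), mul k C (coef k C m a) (mul k C y z) =
      mul k C (mul k C (coef k C m a) y) z :=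
    fun m a y z => LinearMap.congr_fun (hom_ext (hz m · a · z) : mul k C (coef k C m a) ∘ₗ
      (mul k C).flip z = (mul k C).flip z ∘ₗ mul k C (coef k C m a)) y
  exact LinearMap.congr_fun (hom_ext (hy · · y z) : (mul k C).flip (mul k C y z) =
    (mul k C).flip z ∘ₗ (mul k C).flip y) x

theorem deriv_coef (n : ℕ) (a : C) :
    deriv k C (coef k C n a) = -(n • coef k C (n - 1) a) := by
  simp [deriv]

end General

section RightT

variable (k : Type*) [Field k] [CharZero k]

/-- The right multiplication by `t` on `A_+(U(2))`, considered as the right ideal `q W` of the Weyl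
algebra `W = k⟨q, t⟩`, `v(n) = q t ^ n`: it is `a(n) t = a(n + 1) + (ρ a)(n)`. The term with `ρ`
makes it compatible with `(∂a)(n) = -n a(n - 1)`. -/
def rightT : APlus k (U2 k) →ₗ[k] APlus k (U2 k) :=
  lift (fun n => coef k (U2 k) (n + 1) + coef k (U2 k) n ∘ₗ U2.rho k) (fun n a => by
    have h : U2.rho k (AssocConformalAlgebra.der (k := k) a) =
      AssocConformalAlgebra.der (k := k) (U2.rho k a) + a := U2.rho_der k a
    simp only [LinearMap.add_apply, LinearMap.comp_apply, h, map_add, coef_der,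
      Nat.add_sub_cancel]
    cases n with
    | zero => simp
    | succ n => simp only [Nat.add_sub_cancel, add_smul, smul_add, one_smul]; abel)

variable {k}

theorem rightT_coef (n : ℕ) (a : U2 k) : rightT k (coef k (U2 k) n a) =
    coef k (U2 k) (n + 1) a + coef k (U2 k) n (U2.rho k a) := by
  simp [rightT]

/-- Right multiplication by `t` is left `A_+(U(2))`-linear. -/
theorem mul_rightT (x y : APlus k (U2 k)) :
    mul k (U2 k) x (rightT k y) = rightT k (mul k (U2 k) x y) := by
  have h : (mul k (U2 k)).compl₂ (rightT k) = (mul k (U2 k)).compr₂ (rightT k) := by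
    refine hom_ext fun m a => hom_ext fun n b => ?_
    have h1 : ∀ s, U2.rho k (AssocConformalAlgebra.nprod (k := k) s a b) =
      AssocConformalAlgebra.nprod (k := k) s a (U2.rho k b) := fun s => U2.rho_nprod k s a b
    simp only [LinearMap.compl₂_apply, LinearMap.compr₂_apply, rightT_coef, map_add,
      mul_coef_coef, map_sum, map_nsmul, h1, smul_add, Finset.sum_add_distrib, add_assoc]
  exact LinearMap.congr_fun₂ h x y

/-- The identity `[∂, t] = -1`. -/
theorem deriv_rightT (x : APlus k (U2 k)) :
    deriv k (U2 k) (rightT k x) = rightT k (deriv k (U2 k) x) - x := by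
  have h : deriv k (U2 k) ∘ₗ rightT k = rightT k ∘ₗ deriv k (U2 k) - LinearMap.id := by
    refine hom_ext fun n a => ?_
    simp only [LinearMap.comp_apply, LinearMap.sub_apply, LinearMap.id_apply, rightT_coef, map_add,
      deriv_coef, map_neg, map_nsmul, Nat.add_sub_cancel]
    cases n with
    | zero => simp
    | succ n => simp only [Nat.add_sub_cancel, add_smul, smul_add, one_smul]; abel
  exact LinearMap.congr_fun h x

theorem mul_coef_v_coef_v (m n : ℕ) :
    mul k (U2 k) (coef k (U2 k) m (U2.v k)) (coef k (U2 k) n (U2.v k)) =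
      coef k (U2 k) (m + n) (U2.nprod k 0 (U2.v k) (U2.v k)) +
        m • coef k (U2 k) (m - 1 + n) (U2.v k) := by
  have h1 : AssocConformalAlgebra.nprod (k := k) 1 (U2.v k) (U2.v k) = U2.v k :=
    U2.v_nprod_one_v k
  have h2 : ∀ n, AssocConformalAlgebra.nprod (k := k) (n + 2) (U2.v k) (U2.v k) = 0 :=
    fun n => U2.v_nprod_v k _ (by omega)
  rw [mul_coef_coef]
  cases m with
  | zero =>
    simp
    rfl
  | succ m =>
    rw [Finset.Nat.sum_antidiagonal_succ]
    congr 1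
    · simp
      rfl
    · rw [Finset.sum_eq_single (0, m)]
      · simp [h1]
      · rintro ⟨i, j⟩ hp hne
        cases i with
        | zero => simp_all
        | succ i => rw [h2, map_zero, smul_zero]
      · simp

/-- The identity `1 = t q - q t` of the Weyl algebra, multiplied on the left by an element of
`A_+(U(2))`. -/
theorem rightT_mul_sub (x : APlus k (U2 k)) :
    mul k (U2 k) (rightT k x) (coef k (U2 k) 0 (U2.v k)) -
      mul k (U2 k) x (coef k (U2 k) 1 (U2.v k)) = x := by
  let f : APlus k (U2 k) →ₗ[k] APlus k (U2 k) :=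
    (mul k (U2 k)).flip (coef k (U2 k) 0 (U2.v k)) ∘ₗ rightT k -
      (mul k (U2 k)).flip (coef k (U2 k) 1 (U2.v k)) - LinearMap.id
  have hf : ∀ x, f x = mul k (U2 k) (rightT k x) (coef k (U2 k) 0 (U2.v k)) -
      mul k (U2 k) x (coef k (U2 k) 1 (U2.v k)) - x := fun x => rfl
  have hmul : ∀ x y, f y = 0 → f (mul k (U2 k) x y) = 0 := by
    intro x y hy
    rw [hf, ← mul_rightT, ← mul_assoc, ← mul_assoc, ← map_sub, ← map_sub, ← hf, hy, map_zero]
  have htop : (⨅ n, LinearMap.ker (f ∘ₗ coef k (U2 k) n)) = ⊤ := by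
    refine U2.submodule_eq_top k _ ?_ (fun a ha => ?_) (fun s a b _ hb => ?_)
    · simp only [Submodule.mem_iInf, LinearMap.mem_ker, LinearMap.comp_apply]
      intro n
      rw [hf, rightT_coef, U2.rho_v, map_zero, add_zero, mul_coef_v_coef_v, mul_coef_v_coef_v]
      cases n with
      | zero => simp
      | succ n => simp [add_smul]
    · simp only [Submodule.mem_iInf, LinearMap.mem_ker, LinearMap.comp_apply] at ha ⊢
      intro n
      rw [show U2.der k a = AssocConformalAlgebra.der (k := k) a from rfl, coef_der, map_neg,
        map_nsmul, ha, smul_zero, neg_zero]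
    · simp only [Submodule.mem_iInf, LinearMap.mem_ker, LinearMap.comp_apply] at hb ⊢
      -- `a(s) b(n)` is the sum of `(a_(s) b)(n)` and of terms with `a_(i) b`, `i < s`
      induction s using Nat.strong_induction_on with
      | _ s ih =>
        intro n
        have h := hmul (coef k (U2 k) s a) _ (hb n)
        rw [mul_coef_coef, map_sum, Finset.sum_eq_single (s, 0)] at h
        · rw [Nat.choose_self, one_smul, zero_add] at h
          exact h
        · rintro ⟨i, j⟩ hp hne
          simp only [HasAntidiagonal.mem_antidiagonal] at hp
          have hi : i < s := by
            rcases Nat.lt_or_ge i s with h | h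
            · exact h
            · exact absurd (Prod.ext (by simp; omega) (by simp; omega)) hne
          rw [map_nsmul]
          exact (congrArg _ (ih i hi (j + n))).trans (smul_zero _)
        · intro h
          simp at h
  have h0 : f = 0 := hom_ext fun n a => by
    have ha : a ∈ (⨅ n, LinearMap.ker (f ∘ₗ coef k (U2 k) n)) := htop ▸ trivial
    simp only [Submodule.mem_iInf, LinearMap.mem_ker, LinearMap.comp_apply] at ha
    rw [ha, LinearMap.zero_apply]
  have := hf x
  rw [h0, LinearMap.zero_apply] at this
  exact sub_eq_zero.1 this.symm

end RightT

end APlus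

/-! ### Hochschild cochains and the contracting homotopy -/

section Homotopy

theorem contractNth_snoc_castSucc {A : Type*} (f : A → A → A) {n : ℕ} (j : Fin n) (c : Fin (n + 1) → A)
    (x : A) : Fin.contractNth j.castSucc.castSucc f (Fin.snoc c x : Fin (n + 2) → A) =
      (Fin.snoc (Fin.contractNth j.castSucc f c) x : Fin (n + 1) → A) := by
  funext r
  induction r using Fin.lastCases with
  | last =>
    have h : ¬ n < (j : ℕ) := by omega
    have h' : n ≠ (j : ℕ) := by omega
    simp [Fin.contractNth, Fin.snoc, h, h']
  | cast r =>
    simp [Fin.contractNth, Fin.snoc]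
    rfl

theorem contractNth_snoc_last {A : Type*} (f : A → A → A) {n : ℕ} (c : Fin (n + 1) → A)
    (x : A) : Fin.contractNth (Fin.last n).castSucc f (Fin.snoc c x : Fin (n + 2) → A) =
      (Fin.snoc (Fin.init c) (f (c (Fin.last n)) x) : Fin (n + 1) → A) := by
  funext r
  induction r using Fin.lastCases with
  | last => 
    simp [Fin.contractNth, Fin.snoc]
  | cast r => 
    simp [Fin.contractNth, Fin.snoc, Fin.init]

variable {k A M : Type*} [Field k] [AddCommGroup A] [Module k A] [AddCommGroup M] [Module k M]

theorem tail_snoc {A : Type*} {n : ℕ} (c : Fin (n + 1) → A) (x : A) :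
    Fin.tail (Fin.snoc c x : Fin (n + 2) → A) = (Fin.snoc (Fin.tail c) x : Fin (n + 1) → A) := by
  funext r
  induction r using Fin.lastCases with
  | last => simp [Fin.tail]
  | cast r => simp only [Fin.tail, Fin.snoc_castSucc, Fin.succ_castSucc]

theorem snoc_zero {A : Type*} {n : ℕ} (c : Fin (n + 1) → A) (x : A) :
    (Fin.snoc c x : Fin (n + 2) → A) 0 = c 0 :=
  Fin.snoc_castSucc (α := fun _ => A) x c 0

theorem hochschildD_snoc (mul : A →ₗ[k] A →ₗ[k] A) (L : A →ₗ[k] M →ₗ[k] M) (n : ℕ)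
    (φ : Cochain k A M (n + 1)) (c : Fin (n + 1) → A) (x : A) :
    hochschildD mul L 0 (n + 1) φ (Fin.snoc c x : Fin (n + 2) → A) =
      L (c 0) (φ (Fin.snoc (Fin.tail c) x : Fin (n + 1) → A)) +
      ∑ j : Fin n, (-1 : k) ^ ((j : ℕ) + 1) •
        φ (Fin.snoc (Fin.contractNth j.castSucc (fun x y => mul x y) c) x : Fin (n + 1) → A) +
      (-1 : k) ^ (n + 1) •
        φ (Fin.snoc (Fin.init c) (mul (c (Fin.last n)) x) : Fin (n + 1) → A) := by
  have h : ∀ j : Fin n, contractTerm (k := k) mul j.castSucc φ (Fin.snoc c x : Fin (n + 2) → A) =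
      φ (Fin.snoc (Fin.contractNth j.castSucc (fun x y => mul x y) c) x : Fin (n + 1) → A) :=
    fun j => congrArg φ (contractNth_snoc_castSucc _ j c x)
  have h' : contractTerm (k := k) mul (Fin.last n) φ (Fin.snoc c x : Fin (n + 2) → A) =
      φ (Fin.snoc (Fin.init c) (mul (c (Fin.last n)) x) : Fin (n + 1) → A) :=
    congrArg φ (contractNth_snoc_last _ c x)
  have h0 : leftTerm L (n + 1) φ (Fin.snoc c x : Fin (n + 2) → A) =
      L (c 0) (φ (Fin.snoc (Fin.tail c) x : Fin (n + 1) → A)) := by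
    rw [← tail_snoc, ← snoc_zero c x]
    rfl
  have hr : rightTerm (k := k) (0 : A →ₗ[k] M →ₗ[k] M) (n + 1) φ = 0 := rfl
  simp only [hochschildD, LinearMap.add_apply, LinearMap.smul_apply, LinearMap.sum_apply, hr,
    smul_zero, add_zero, add_apply, _root_.sum_apply,
    smul_apply, h0, Fin.sum_univ_castSucc, h, h', Fin.val_castSucc, Fin.val_last,
    add_assoc]

theorem cochainDer_apply (dA : A →ₗ[k] A) (dM : M →ₗ[k] M) (n : ℕ) (φ : Cochain k A M n)
    (a : Fin n → A) : cochainDer dA dM n φ a =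
      dM (φ a) - ∑ i, φ (Function.update a i (dA (a i))) := by
  simp only [cochainDer, LinearMap.coe_mk, AddHom.coe_mk, sub_apply, _root_.sum_apply,
    LinearMap.compMultilinearMap_apply, MultilinearMap.compLinearMap_apply]
  congr 1
  refine Finset.sum_congr rfl fun i _ => congrArg φ (funext fun j => ?_)
  by_cases h : j = i
  · subst h; simp
  · simp [h]

theorem cochainDer_snoc (dA : A →ₗ[k] A) (dM : M →ₗ[k] M) (n : ℕ) (φ : Cochain k A M (n + 1))
    (c : Fin n → A) (x : A) :
    cochainDer dA dM (n + 1) φ (Fin.snoc c x : Fin (n + 1) → A) =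
      dM (φ (Fin.snoc c x : Fin (n + 1) → A)) -
      (∑ i, φ (Fin.snoc (Function.update c i (dA (c i))) x : Fin (n + 1) → A) +
        φ (Fin.snoc c (dA x) : Fin (n + 1) → A)) := by
  rw [cochainDer_apply, Fin.sum_univ_castSucc]
  simp [Fin.snoc_update, Fin.update_snoc_last]

/-- The cochain `(a_1, …, a_{n+1}) ↦ φ(a_1, …, a_n, f a_{n+1}, e)`. -/
def lastTerm (f : A →ₗ[k] A) (e : A) (n : ℕ) :
    Cochain k A M (n + 2) →ₗ[k] Cochain k A M (n + 1) where
  toFun φ := ((LinearMap.applyₗ e : (A →ₗ[k] M) →ₗ[k] M).compMultilinearMap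
    φ.curryRight).compLinearMap (fun j => if j = Fin.last n then f else LinearMap.id)
  map_add' _ _ := rfl
  map_smul' _ _ := rfl

theorem lastTerm_snoc (f : A →ₗ[k] A) (e : A) (n : ℕ) (φ : Cochain k A M (n + 2))
    (c : Fin n → A) (x : A) : lastTerm f e n φ (Fin.snoc c x : Fin (n + 1) → A) =
      φ (Fin.snoc (Fin.snoc c (f x) : Fin (n + 1) → A) e : Fin (n + 2) → A) := by
  change φ (Fin.snoc _ e : Fin (n + 2) → A) = _
  congr 2
  funext j
  induction j using Fin.lastCases with
  | last => simp
  | cast j => simp [Fin.castSucc_ne_last]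

/-- The homotopy `(sφ)(a_1, …, a_{n+1}) = φ(a_1, …, a_n, a_{n+1} t, q) - φ(a_1, …, a_{n+1}, p)`,
where `T` is the right multiplication by `t` and `p` plays the role of `q t`. -/
def homotopy (T : A →ₗ[k] A) (q p : A) (n : ℕ) :
    Cochain k A M (n + 2) →ₗ[k] Cochain k A M (n + 1) :=
  lastTerm T q n - lastTerm LinearMap.id p n

theorem homotopy_snoc (T : A →ₗ[k] A) (q p : A) (n : ℕ) (φ : Cochain k A M (n + 2))
    (c : Fin n → A) (x : A) : homotopy T q p n φ (Fin.snoc c x : Fin (n + 1) → A) =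
      φ (Fin.snoc (Fin.snoc c (T x) : Fin (n + 1) → A) q : Fin (n + 2) → A) -
        φ (Fin.snoc (Fin.snoc c x : Fin (n + 1) → A) p : Fin (n + 2) → A) := by
  rw [homotopy, LinearMap.sub_apply, sub_apply, lastTerm_snoc, lastTerm_snoc, LinearMap.id_apply]

theorem cochain_snoc_sub_last {n : ℕ} (φ : Cochain k A M (n + 1)) (c : Fin n → A) (x y : A) :
    φ (Fin.snoc c (x - y) : Fin (n + 1) → A) =
      φ (Fin.snoc c x : Fin (n + 1) → A) - φ (Fin.snoc c y : Fin (n + 1) → A) :=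
  map_sub (φ.curryRight c) x y

theorem cochain_ext_snoc {n : ℕ} {φ ψ : Cochain k A M (n + 1)}
    (h : ∀ (c : Fin n → A) (x : A),
      φ (Fin.snoc c x : Fin (n + 1) → A) = ψ (Fin.snoc c x : Fin (n + 1) → A)) : φ = ψ := by
  ext a
  rw [← Fin.snoc_init_self a]
  exact h _ _

/-- In `s(dφ)` all terms of `dφ` but the last one give `d(sφ)`; the last one, in which the two new
arguments are multiplied, gives `± φ` since `x = (x t) q - x (q t)`. -/
theorem homotopy_hochschildD (mul : A →ₗ[k] A →ₗ[k] A) (L : A →ₗ[k] M →ₗ[k] M) (T : A →ₗ[k] A)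
    (q p : A) (hT : ∀ x y, mul x (T y) = T (mul x y))
    (hqp : ∀ x, mul (T x) q - mul x p = x) (n : ℕ) (φ : Cochain k A M (n + 2)) :
    homotopy T q p (n + 1) (hochschildD mul L 0 (n + 2) φ) =
      hochschildD mul L 0 (n + 1) (homotopy T q p n φ) + (-1 : k) ^ n • φ := by
  refine cochain_ext_snoc fun c x => ?_
  have h := cochain_snoc_sub_last φ c (mul (T x) q) (mul x p)
  rw [hqp] at h
  rw [homotopy_snoc, add_apply, smul_apply, h]
  simp only [hochschildD_snoc, homotopy_snoc, Fin.sum_univ_castSucc, contractNth_snoc_castSucc,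
    contractNth_snoc_last, tail_snoc, snoc_zero, Fin.init_snoc, Fin.snoc_last, Fin.val_castSucc, Fin.val_last, hT,
    map_sub, smul_sub, Finset.sum_sub_distrib, pow_succ]
  module

/-- The homotopy commutes with `D` because `∂` annihilates `t ⊗ q - 1 ⊗ p`. -/
theorem homotopy_cochainDer (dA : A →ₗ[k] A) (dM : M →ₗ[k] M) (T : A →ₗ[k] A) (q p : A)
    (hT : ∀ x, dA (T x) = T (dA x) - x) (hq : dA q = 0) (hp : dA p = -q) (n : ℕ)
    (φ : Cochain k A M (n + 2)) :
    homotopy T q p n (cochainDer dA dM (n + 2) φ) =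
      cochainDer dA dM (n + 1) (homotopy T q p n φ) := by
  refine cochain_ext_snoc fun c x => ?_
  rw [homotopy_snoc]
  have h0 : ∀ c' : Fin (n + 1) → A, φ (Fin.snoc c' (0 : A) : Fin (n + 2) → A) = 0 :=
    fun c' => map_zero (φ.curryRight c')
  have hn : ∀ c' : Fin (n + 1) → A, φ (Fin.snoc c' (-q) : Fin (n + 2) → A) =
      -φ (Fin.snoc c' q : Fin (n + 2) → A) := fun c' => map_neg (φ.curryRight c') q
  have hs : φ (Fin.snoc (Fin.snoc c (T (dA x) - x) : Fin (n + 1) → A) q : Fin (n + 2) → A) =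
      φ (Fin.snoc (Fin.snoc c (T (dA x)) : Fin (n + 1) → A) q : Fin (n + 2) → A) -
      φ (Fin.snoc (Fin.snoc c x : Fin (n + 1) → A) q : Fin (n + 2) → A) :=
    map_sub ((φ.curryRight.curryRight c).flip q) _ _
  simp only [cochainDer_snoc, homotopy_snoc, Fin.sum_univ_castSucc, Fin.snoc_castSucc,
    Fin.snoc_last, ← Fin.snoc_update, Fin.update_snoc_last, map_sub, hT, hq, hp, h0, hn, hs,
    Finset.sum_sub_distrib]
  abel

end Homotopy

/-! ### Reduced cohomology -/

section Reduced

variable {k : Type*} [Field k]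

/-- A homotopy which commutes with `D` and preserves `S^•` contracts the reduced complex: if
`dφ = Dψ`, then `± φ = s(Dψ) - d(sφ) = D(sψ) - d(sφ)`. -/
theorem reducedCohomology_subsingleton {C M : Type*} [AddCommGroup C] [Module k C]
    [AssocConformalAlgebra k C] [AddCommGroup M] [Module k M] [ConformalModule k C M]
    (S : ∀ n, Submodule k (BasicCochain k C M n)) (n : ℕ)
    (s : ∀ n, BasicCochain k C M (n + 2) →ₗ[k] BasicCochain k C M (n + 1))
    (hS : ∀ n, ∀ φ ∈ S (n + 2), s n φ ∈ S (n + 1))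
    (hd : ∀ n φ, s (n + 1) (basicD k C M (n + 2) φ) =
      basicD k C M (n + 1) (s n φ) + (-1 : k) ^ n • φ)
    (hD : ∀ n φ, s n (basicDer k C M (n + 2) φ) = basicDer k C M (n + 1) (s n φ)) :
    Subsingleton (ReducedCohomology S (n + 2)) := by
  rw [Submodule.Quotient.subsingleton_iff, Submodule.submoduleOf_eq_top]
  rintro φ ⟨hφ, ψ, hψ, hφψ⟩
  have h := hd n φ
  rw [← hφψ, hD] at h
  have h2 : φ = basicD k C M (n + 1) (-((-1 : k) ^ n • s n φ)) +
      basicDer k C M (n + 2) ((-1 : k) ^ n • s (n + 1) ψ) := by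
    rw [map_neg, map_smul, map_smul, h, smul_add, smul_smul, ← mul_pow]
    simp
  rw [h2]
  exact Submodule.add_mem_sup
    (Submodule.mem_map_of_mem (neg_mem (Submodule.smul_mem _ _ (hS n φ hφ))))
    (Submodule.mem_map_of_mem (Submodule.smul_mem _ _ (hS (n + 1) ψ hψ)))

variable [CharZero k] (M : Type*) [AddCommGroup M] [Module k M]

variable (k) in
/-- The homotopy on the basic cochains of `U(2)`, given by the element `t ⊗ q - 1 ⊗ q t`, where
`q = v(0)` and `q t = v(1)`. -/
def u2Homotopy (n : ℕ) : BasicCochain k (U2 k) M (n + 2) →ₗ[k] BasicCochain k (U2 k) M (n + 1) :=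
  homotopy (APlus.rightT k) (APlus.coef k (U2 k) 0 (U2.v k)) (APlus.coef k (U2 k) 1 (U2.v k)) n

theorem u2Homotopy_mem_localCochains (n : ℕ) (φ : BasicCochain k (U2 k) M (n + 2))
    (hφ : φ ∈ localCochains k (U2 k) M (n + 2)) :
    u2Homotopy k M n φ ∈ localCochains k (U2 k) M (n + 1) := by
  intro a
  -- `φ` vanishes on the tuples `(b(m), v(r))` with `m` large
  have key : ∀ b : Fin (n + 1) → U2 k, ∃ N : ℕ, ∀ (m : Fin (n + 1) → ℕ) (r : ℕ), (∃ i, N ≤ m i) →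
      φ (Fin.snoc (fun i => APlus.coef k (U2 k) (m i) (b i)) (APlus.coef k (U2 k) r (U2.v k)) :
        Fin (n + 2) → APlus k (U2 k)) = 0 := by
    intro b
    obtain ⟨N, hN⟩ := hφ (Fin.snoc b (U2.v k) : Fin (n + 2) → U2 k)
    refine ⟨N, fun m r ⟨i, hi⟩ => ?_⟩
    rw [← hN (Fin.snoc m r : Fin (n + 2) → ℕ) ⟨i.castSucc, by rwa [Fin.snoc_castSucc]⟩]
    congr 1
    funext j
    induction j using Fin.lastCases with
    | last => simp
    | cast j => simp
  have hs : ∀ (m : Fin (n + 1) → ℕ) (b : Fin (n + 1) → U2 k),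
      (fun i => APlus.coef k (U2 k) (m i) (b i)) =
      (Fin.snoc (fun i : Fin n => APlus.coef k (U2 k) (m i.castSucc) (b i.castSucc))
        (APlus.coef k (U2 k) (m (Fin.last n)) (b (Fin.last n))) : Fin (n + 1) → _) := by
    intro m b
    exact (Fin.snoc_init_self (α := fun _ => APlus k (U2 k)) _).symm
  obtain ⟨N, hN⟩ := key a
  obtain ⟨N', hN'⟩ := key (Function.update a (Fin.last n) (U2.rho k (a (Fin.last n))))
  refine ⟨N + N', fun m ⟨i, hi⟩ => ?_⟩
  have h1 := hN (Function.update m (Fin.last n) (m (Fin.last n) + 1)) 0 ⟨i, by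
    by_cases h : i = Fin.last n
    · subst h; rw [Function.update_self]; omega
    · rw [Function.update_of_ne h]; omega⟩
  have h2 := hN' m 0 ⟨i, by omega⟩
  have h3 := hN m 1 ⟨i, by omega⟩
  rw [hs] at h1 h2 h3 ⊢
  simp only [Function.update_self, Function.update_of_ne (Fin.castSucc_ne_last _)] at h1 h2
  have hadd : ∀ (c : Fin n → APlus k (U2 k)) (x y z : APlus k (U2 k)),
      φ (Fin.snoc (Fin.snoc c (x + y) : Fin (n + 1) → APlus k (U2 k)) z : Fin (n + 2) → _) =
      φ (Fin.snoc (Fin.snoc c x : Fin (n + 1) → APlus k (U2 k)) z : Fin (n + 2) → _) +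
      φ (Fin.snoc (Fin.snoc c y : Fin (n + 1) → APlus k (U2 k)) z : Fin (n + 2) → _) :=
    fun c x y z => map_add ((φ.curryRight.curryRight c).flip z) x y
  rw [u2Homotopy, homotopy_snoc, APlus.rightT_coef, hadd, h1, h2, h3, add_zero, sub_zero]

variable [ConformalModule k (U2 k) M]

theorem u2Homotopy_basicD (n : ℕ) (φ : BasicCochain k (U2 k) M (n + 2)) :
    u2Homotopy k M (n + 1) (basicD k (U2 k) M (n + 2) φ) =
      basicD k (U2 k) M (n + 1) (u2Homotopy k M n φ) + (-1 : k) ^ n • φ :=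
  homotopy_hochschildD _ _ _ _ _ APlus.mul_rightT APlus.rightT_mul_sub n φ

theorem u2Homotopy_basicDer (n : ℕ) (φ : BasicCochain k (U2 k) M (n + 2)) :
    u2Homotopy k M n (basicDer k (U2 k) M (n + 2) φ) =
      basicDer k (U2 k) M (n + 1) (u2Homotopy k M n φ) :=
  homotopy_cochainDer _ _ _ _ _ APlus.deriv_rightT (by simp [APlus.deriv_coef])
    (by simp [APlus.deriv_coef]) n φ

end Reduced

end Conformal

end

theorem mainTheorem5 (k : Type*) [Field k] [CharZero k] (α : k) (n : ℕ) (hn : 2 ≤ n) :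
    Subsingleton (Conformal.HochschildCohomology k (Conformal.U2 k) (Conformal.MAlphaZero α) n) ∧
    Subsingleton
      (Conformal.LocalHochschildCohomology k (Conformal.U2 k) (Conformal.MAlphaZero α) n) := by
  obtain ⟨n, rfl⟩ := Nat.exists_eq_add_of_le' hn
  exact ⟨Conformal.reducedCohomology_subsingleton _ n (Conformal.u2Homotopy k _)
      (fun _ _ _ => Submodule.mem_top) (Conformal.u2Homotopy_basicD _)
      (Conformal.u2Homotopy_basicDer _),
    Conformal.reducedCohomology_subsingleton _ n (Conformal.u2Homotopy k _)
      (Conformal.u2Homotopy_mem_localCochains _) (Conformal.u2Homotopy_basicD _)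
      (Conformal.u2Homotopy_basicDer _)⟩
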